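/- Let $N$ be a free abelian group of rank $n$, $M_{\mathbb Q}=\mathbb Q\otimes\operatorname{Hom}(N,\mathbb Z)$, and let $\Sigma$ be a simplicial fan in $N_{\mathbb Q}=\mathbb Q\otimes N$ (finite, with strongly convex rational polyhedral cones) such that every cone of $\Sigma$ is contained in an $n$-dimensional cone of $\Sigma$. Let $X=X(\Sigma)$ be its toric variety. Let $Z_k(X)_{\mathbb Q}$ be the $\mathbb Q$-vector space with basis $[V(\sigma)]$, $\sigma\in\Sigma$ of dimension $n-k$, and $Z_*(X)_{\mathbb Q}=\bigoplus_k Z_k(X)_{\mathbb Q}$. For $\sigma\in\Sigma$ put $M(\sigma)=\sigma^\perp\subseteq M_{\mathbb Q}$ and $M_\sigma=M_{\mathbb Q}/M(\sigma)$, let $N_\sigma$ be the subgroup of $N$ generated by $\sigma\cap N$, and let $N(\sigma)=N/N_\sigma$. A $\mathbb Q$-Cartier divisor $D$ is a family of $m_\sigma\in M_\sigma$ $(\sigma\in\Sigma)$ such that $m_\sigma\mapsto m_\tau$ whenever $\tau$ is a face of $\sigma$; its cycle is $[D]=\sum_\rho\langle m_\rho,v_\rho\rangle[V(\rho)]$,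 over the rays $\rho$ with first lattice points $v_\rho$. Since $\Sigma$ is simplicial, for every ray $\rho_i$ there is a unique $\mathbb Q$-Cartier divisor $D_i$ with $[D_i]=[V(\rho_i)]$. An inner product on $M_{\mathbb Q}$ (a positive definite symmetric $\mathbb Q$-valued bilinear form) gives orthogonal projections $\pi_\sigma:M_{\mathbb Q}\to M(\sigma)$ and an action of $\mathbb Q$-Cartier divisors on $Z_*(X)_{\mathbb Q}$: $$D\cdot[V(\sigma)]=\sum_{\tau}\langle\pi_\sigma(m_\tau),n_{\tau,\sigma}\rangle\,[V(\tau)],$$ where $\tau$ runs over the cones of $\Sigma$ that have $\sigma$ as a facet, and $n_{\tau,\sigma}\in N(\sigma)$ is the first lattice point on the image of $\tau$ in $N(\sigma)\otimes\mathbb Q$. Multiplication by $D^k$ is the $k$-fold iterate of this action. Let $\omega=\sum_i a_iD_i$ with all $a_i\in\mathbb Q$ non-zero. Then, for a generic inner product on $M_{\mathbb Q}$, multiplication by $\omega^{n-2i}$ maps $Z_{n-i}(X)_{\mathbb Q}$ injectively into $Z_i(X)_{\mathbb Q}$ for all integers $i$ with $0\le i\le n/2$. Here "for a generic inner product" means: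 having identified inner products with positive definite symmetric rational $n\times n$ matrices by means of a basis of $M_{\mathbb Q}$, there is a non-empty Zariski-open set $S$ of symmetric rational $n\times n$ matrices such that the assertion holds for every inner product whose matrix lies in $S$. -/

import Mathlib

open scoped TensorProduct

noncomputable section

namespace Toric

/-! ### Lattices, cones and fans

`N` is a lattice (a free abelian group of finite rank).  All cones live in `N_ℚ = ℚ ⊗ N`. -/

/-- The rational vector space `N_ℚ = ℚ ⊗ N`. -/
abbrev NQ (N : Type*) [AddCommGroup N] : Type _ := ℚ ⊗[ℤ] N

/-- The rational vector space `M_ℚ = ℚ ⊗ Hom(N, ℤ)`, realised as the dual space of `N_ℚ`. -/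
abbrev MQ (N : Type*) [AddCommGroup N] : Type _ := Module.Dual ℚ (NQ N)

/-- The canonical map `N → N_ℚ`, `x ↦ 1 ⊗ x`. -/
def toNQ (N : Type*) [AddCommGroup N] : N →ₗ[ℤ] NQ N := TensorProduct.mk ℤ ℚ N 1

section Cones

variable {N : Type*} [AddCommGroup N]

/-- The linear span of a cone. -/
def linSpan (σ : PointedCone ℚ (NQ N)) : Submodule ℚ (NQ N) :=
  Submodule.span ℚ (σ : Set (NQ N))

/-- The dimension of a cone: the dimension of its linear span. -/
def dim (σ : PointedCone ℚ (NQ N)) : ℕ := Module.finrank ℚ (linSpan σ)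

/-- A cone is rational polyhedral if it is generated by finitely many lattice points. -/
def IsRationalPolyhedral (σ : PointedCone ℚ (NQ N)) : Prop :=
  ∃ s : Finset N, σ = PointedCone.hull ℚ (toNQ N '' (s : Set N))

/-- `M(σ) = σ^⊥ ⊆ M_ℚ`, the functionals that vanish on `σ`. -/
def perp (σ : PointedCone ℚ (NQ N)) : Submodule ℚ (MQ N) := (linSpan σ).dualAnnihilator

/-- `N_σ`, the subgroup of `N` generated by `σ ∩ N`. -/
def latticeSpan (σ : PointedCone ℚ (NQ N)) : Submodule ℤ N :=
  Submodule.span ℤ {x : N | toNQ N x ∈ σ}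

/-- `σ` is a facet of `τ` (written `τ → σ`): a face of dimension one less. -/
structure IsFacetOf (σ τ : PointedCone ℚ (NQ N)) : Prop where
  face : σ.IsFaceOf τ
  dim_eq : dim τ = dim σ + 1

/-- `v ∈ τ ∩ N` represents the generator of the one-dimensional image of `τ ∩ N` in
`N(σ) = N / N_σ`, where `σ` is a facet of `τ`: the class of `v` is nonzero and every lattice point
of `τ` is congruent to a natural multiple of `v` modulo `N_σ`. -/
structure IsFacetGenerator (σ τ : PointedCone ℚ (NQ N)) (v : N) : Prop where
  mem : toNQ N v ∈ τ
  notMem : v ∉ latticeSpan σ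
  generates : ∀ w : N, toNQ N w ∈ τ → ∃ k : ℕ, w - k • v ∈ latticeSpan σ

theorem le_linSpan {σ : PointedCone ℚ (NQ N)} {x : NQ N} (hx : x ∈ σ) : x ∈ linSpan σ :=
  Submodule.subset_span hx

theorem linSpan_mono {σ τ : PointedCone ℚ (NQ N)} (h : σ ≤ τ) : linSpan σ ≤ linSpan τ :=
  Submodule.span_mono h

theorem perp_anti {σ τ : PointedCone ℚ (NQ N)} (h : σ ≤ τ) : perp τ ≤ perp σ :=
  Submodule.dualAnnihilator_anti (linSpan_mono h)

theorem apply_eq_zero_of_mem_perp {σ : PointedCone ℚ (NQ N)} {m : MQ N} (hm : m ∈ perp σ)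
    {x : NQ N} (hx : x ∈ σ) : m x = 0 :=
  (Submodule.mem_dualAnnihilator m).1 hm x (le_linSpan hx)

theorem exists_sub_of_mem_linSpan {σ : PointedCone ℚ (NQ N)} {x : NQ N} (hx : x ∈ linSpan σ) :
    ∃ y ∈ σ, ∃ z ∈ σ, x = y - z := by
  induction hx using Submodule.span_induction with
  | mem x h => exact ⟨x, h, 0, zero_mem _, by simp⟩
  | zero => exact ⟨0, zero_mem _, 0, zero_mem _, by simp⟩
  | add x y _ _ hx hy =>
    obtain ⟨a, ha, b, hb, rfl⟩ := hx
    obtain ⟨c, hc, d, hd, rfl⟩ := hy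
    exact ⟨a + c, add_mem ha hc, b + d, add_mem hb hd, by abel⟩
  | smul q x _ hx =>
    obtain ⟨a, ha, b, hb, rfl⟩ := hx
    rcases le_total 0 q with hq | hq
    · exact ⟨q • a, σ.smul_mem hq ha, q • b, σ.smul_mem hq hb, by rw [smul_sub]⟩
    · refine ⟨(-q) • b, σ.smul_mem (by linarith) hb, (-q) • a, σ.smul_mem (by linarith) ha, ?_⟩
      rw [smul_sub, neg_smul, neg_smul]; abel

theorem mem_face_of_mem_linSpan {σ τ : PointedCone ℚ (NQ N)} (h : σ.IsFaceOf τ) {x : NQ N}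
    (hx : x ∈ τ) (hx' : x ∈ linSpan σ) : x ∈ σ := by
  obtain ⟨y, hy, z, hz, rfl⟩ := exists_sub_of_mem_linSpan hx'
  exact h.mem_of_add_mem_left hx (h.le hz) (by simpa using hy)

theorem exists_nsmul_eq_toNQ (x : NQ N) : ∃ k : ℕ, 0 < k ∧ ∃ y : N, (k : ℚ) • x = toNQ N y := by
  induction x using TensorProduct.induction_on with
  | zero => exact ⟨1, one_pos, 0, by simp⟩
  | tmul q y =>
    refine ⟨q.den, q.den_pos, q.num • y, ?_⟩
    have : toNQ N (q.num • y) = (q.num : ℚ) ⊗ₜ[ℤ] y := by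
      change (1 : ℚ) ⊗ₜ[ℤ] (q.num • y) = _
      rw [← TensorProduct.smul_tmul]; simp
    rw [this, TensorProduct.smul_tmul', smul_eq_mul, Rat.den_mul_eq_num]
  | add x y hx hy =>
    obtain ⟨a, ha, u, hu⟩ := hx
    obtain ⟨b, hb, v, hv⟩ := hy
    refine ⟨a * b, Nat.mul_pos ha hb, b • u + a • v, ?_⟩
    rw [map_add, map_nsmul, map_nsmul, ← hu, ← hv, smul_add]
    simp only [← Nat.cast_smul_eq_nsmul ℚ, smul_smul]
    push_cast
    rw [mul_comm (b : ℚ)]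

theorem exists_integral_multiple [Module.Finite ℤ N] (f : MQ N) :
    ∃ d : ℕ, 0 < d ∧ ∃ g : N → ℤ, ∀ x, (g x : ℚ) = d * f (toNQ N x) := by
  obtain ⟨s, hs⟩ := (Module.Finite.fg_top : (⊤ : Submodule ℤ N).FG)
  have key : ∀ x ∈ Submodule.span ℤ (s : Set N),
      ∃ z : ℤ, (z : ℚ) = ((∏ y ∈ s, (f (toNQ N y)).den : ℕ) : ℚ) * f (toNQ N x) := by
    intro x hx
    induction hx using Submodule.span_induction with
    | mem x h =>
      obtain ⟨c, hc⟩ := Finset.dvd_prod_of_mem (fun y => (f (toNQ N y)).den) h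
      refine ⟨c * (f (toNQ N x)).num, ?_⟩
      rw [hc]; push_cast
      rw [mul_comm _ (c : ℚ), mul_assoc, Rat.den_mul_eq_num]
    | zero => exact ⟨0, by simp⟩
    | add x y _ _ hx hy =>
      obtain ⟨a, ha⟩ := hx
      obtain ⟨b, hb⟩ := hy
      exact ⟨a + b, by rw [Int.cast_add, ha, hb, map_add, map_add, mul_add]⟩
    | smul q x _ hx =>
      obtain ⟨a, ha⟩ := hx
      refine ⟨q * a, ?_⟩
      rw [map_smul, map_zsmul, Int.cast_mul, ha, zsmul_eq_mul]; ring
  rw [hs] at key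
  choose g hg using fun x => key x trivial
  exact ⟨_, Finset.prod_pos fun y _ => (f (toNQ N y)).den_pos, g, hg⟩

theorem toNQ_mem_linSpan {σ : PointedCone ℚ (NQ N)} {x : N} (hx : x ∈ latticeSpan σ) :
    toNQ N x ∈ linSpan σ := by
  induction hx using Submodule.span_induction with
  | mem x h => exact le_linSpan h
  | zero => simp
  | add x y _ _ hx hy => rw [map_add]; exact add_mem hx hy
  | smul q x _ hx => rw [map_zsmul]; exact zsmul_mem hx q

theorem mem_latticeSpan {σ : PointedCone ℚ (NQ N)} {x : N} (hx : toNQ N x ∈ linSpan σ) :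
    x ∈ latticeSpan σ := by
  obtain ⟨y, hy, z, hz, h⟩ := exists_sub_of_mem_linSpan hx
  obtain ⟨k, hk, u, hu⟩ := exists_nsmul_eq_toNQ z
  have hk1 : (1 : ℚ) ≤ k := by exact_mod_cast hk
  have h1 : toNQ N u ∈ σ := hu ▸ σ.smul_mem (by positivity) hz
  have h2 : toNQ N (x + u) ∈ σ := by
    have : toNQ N (x + u) = y + ((k : ℚ) - 1) • z := by
      rw [map_add, h, ← hu, sub_smul, one_smul]; abel
    rw [this]
    exact add_mem hy (σ.smul_mem (by linarith) hz)
  have : x = (x + u) - u := by abel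
  rw [this]
  exact sub_mem (Submodule.subset_span h2) (Submodule.subset_span h1)

/-- For every facet `σ` of `τ` the generator `n_{τ,σ}` exists. -/
theorem exists_facetGenerator [Module.Finite ℤ N] {σ τ : PointedCone ℚ (NQ N)}
    (h : IsFacetOf σ τ) : ∃ v : N, IsFacetGenerator σ τ v := by
  have hle : linSpan σ ≤ linSpan τ := linSpan_mono h.face.le
  have hfd : Module.finrank ℚ (linSpan τ) = Module.finrank ℚ (linSpan σ) + 1 := h.dim_eq
  -- a point of `τ` outside the span of `σ`
  obtain ⟨t, htτ, htσ⟩ : ∃ t ∈ τ, t ∉ linSpan σ := by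
    by_contra! hc
    have : linSpan τ ≤ linSpan σ := Submodule.span_le.2 hc
    have := le_antisymm this hle
    rw [this] at hfd
    omega
  obtain ⟨f, hft, hfσ⟩ := Submodule.exists_le_ker_of_notMem htσ
  wlog hpos : 0 < f t generalizing f
  · refine this (-f) (by simpa using hft) ?_ ?_
    · intro x hx; simpa using hfσ hx
    · have : f t ≠ 0 := hft
      rcases lt_or_gt_of_ne this with h' | h'
      · simpa using h'
      · exact absurd h' hpos
  have hspan : linSpan τ = linSpan σ ⊔ Submodule.span ℚ {t} := by
    symm
    apply Submodule.eq_of_le_of_finrank_le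
    · exact sup_le hle ((Submodule.span_singleton_le_iff_mem _ _).2 (le_linSpan htτ))
    · rw [hfd]
      apply Nat.succ_le_of_lt
      apply Submodule.finrank_lt_finrank_of_lt
      refine lt_of_le_of_ne le_sup_left fun he => htσ ?_
      rw [he]
      exact Submodule.mem_sup_right (Submodule.mem_span_singleton_self t)
  have hker : ∀ x ∈ linSpan τ, f x = 0 → x ∈ linSpan σ := by
    intro x hx hx0
    rw [hspan] at hx
    obtain ⟨y, hy, z, hz, rfl⟩ := Submodule.mem_sup.1 hx
    obtain ⟨c, rfl⟩ := Submodule.mem_span_singleton.1 hz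
    have hy0 : f y = 0 := hfσ hy
    rw [map_add, map_smul, hy0, zero_add, smul_eq_mul] at hx0
    have : c = 0 := (mul_eq_zero.1 hx0).resolve_right hpos.ne'
    simpa [this] using hy
  have hnn : ∀ x ∈ τ, 0 ≤ f x := by
    intro x hx
    by_contra! hneg
    have hc : 0 < - f x / f t := div_pos (by linarith) hpos
    have hm : x + (- f x / f t) • t ∈ linSpan σ := by
      apply hker
      · exact add_mem (le_linSpan hx) (Submodule.smul_mem _ _ (le_linSpan htτ))
      · rw [map_add, map_smul, smul_eq_mul]; field_simp; ring
    have hm2 : x + (- f x / f t) • t ∈ σ :=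
      mem_face_of_mem_linSpan h.face (add_mem hx (τ.smul_mem hc.le htτ)) hm
    have hxσ := h.face.mem_of_add_mem_left hx (τ.smul_mem hc.le htτ) hm2
    have : f x = 0 := hfσ (le_linSpan hxσ)
    linarith
  obtain ⟨d, hd, g, hg⟩ := exists_integral_multiple f
  have hdQ : (0 : ℚ) < d := by exact_mod_cast hd
  -- a lattice point of `τ` with positive value, minimal among these
  have hex : ∃ k : ℕ, ∃ v : N, toNQ N v ∈ τ ∧ 0 < g v ∧ (g v).toNat = k := by
    obtain ⟨k, hk, y, hy⟩ := exists_nsmul_eq_toNQ t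
    have hkQ : (0 : ℚ) < k := by exact_mod_cast hk
    refine ⟨_, y, hy ▸ τ.smul_mem hkQ.le htτ, ?_, rfl⟩
    have : (0 : ℚ) < g y := by
      rw [hg, ← hy, map_smul, smul_eq_mul]; positivity
    exact_mod_cast this
  classical
  obtain ⟨v, hvτ, hvpos, hvk⟩ := Nat.find_spec hex
  have hmin : ∀ w : N, toNQ N w ∈ τ → 0 < g w → g v ≤ g w := by
    intro w hw hw0
    have := Nat.find_min' hex ⟨w, hw, hw0, rfl⟩
    omega
  have hvQ : (0 : ℚ) < g v := by exact_mod_cast hvpos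
  have hfv : 0 < f (toNQ N v) := by
    have := hg v
    rw [this] at hvQ
    exact (mul_pos_iff_of_pos_left hdQ).1 hvQ
  refine ⟨v, hvτ, ?_, ?_⟩
  · intro hv
    have : f (toNQ N v) = 0 := hfσ (toNQ_mem_linSpan hv)
    linarith
  · intro w hw
    have hgw : 0 ≤ g w := by
      have : (0 : ℚ) ≤ g w := by rw [hg]; exact mul_nonneg hdQ.le (hnn _ hw)
      exact_mod_cast this
    obtain ⟨k, hk⟩ := Int.eq_ofNat_of_zero_le (Int.ediv_nonneg hgw hvpos.le)
    refine ⟨k, ?_⟩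
    set r : N := w - k • v with hr
    have hrτ : toNQ N r ∈ linSpan τ := by
      rw [hr, map_sub, map_nsmul]
      exact sub_mem (le_linSpan hw) (nsmul_mem (le_linSpan hvτ) k)
    have hgr : g r = g w % g v := by
      have : (g r : ℚ) = g w - k * g v := by
        rw [hg, hg, hg, hr, map_sub, map_nsmul, map_sub, map_nsmul, nsmul_eq_mul]; ring
      have h2 : g r = g w - k * g v := by exact_mod_cast this
      rw [h2, Int.emod_def, hk]; simp [mul_comm]
    have hr0 : 0 ≤ g r := hgr ▸ Int.emod_nonneg _ hvpos.ne'
    have hr1 : g r < g v := hgr ▸ Int.emod_lt_of_pos _ hvpos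
    have hr0Q : (0 : ℚ) ≤ g r := by exact_mod_cast hr0
    have hfr : 0 ≤ f (toNQ N r) := by
      rw [hg] at hr0Q
      exact nonneg_of_mul_nonneg_right hr0Q hdQ
    have hc : 0 ≤ f (toNQ N r) / f (toNQ N v) := div_nonneg hfr hfv.le
    have hdiff : toNQ N r - (f (toNQ N r) / f (toNQ N v)) • toNQ N v ∈ linSpan σ := by
      apply hker
      · exact sub_mem hrτ (Submodule.smul_mem _ _ (le_linSpan hvτ))
      · rw [map_sub, map_smul, smul_eq_mul]; field_simp; ring
    obtain ⟨s₁, hs₁, s₂, hs₂, he⟩ := exists_sub_of_mem_linSpan hdiff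
    obtain ⟨K, hK, u, hu⟩ := exists_nsmul_eq_toNQ s₂
    have hK1 : (1 : ℚ) ≤ K := by exact_mod_cast hK
    have huσ : toNQ N u ∈ σ := hu ▸ σ.smul_mem (by positivity) hs₂
    have hru : toNQ N (r + u) ∈ τ := by
      have : toNQ N (r + u) = (f (toNQ N r) / f (toNQ N v)) • toNQ N v
          + (s₁ + ((K : ℚ) - 1) • s₂) := by
        have he' := sub_eq_iff_eq_add.1 he
        generalize f (toNQ N r) / f (toNQ N v) = c at he' ⊢
        rw [map_add, ← hu, sub_smul, one_smul, he']; abel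
      rw [this]
      exact add_mem (τ.smul_mem hc hvτ)
        (h.face.le (add_mem hs₁ (σ.smul_mem (by linarith) hs₂)))
    have hgru : g (r + u) = g r := by
      have hu0 : f (toNQ N u) = 0 := hfσ (le_linSpan huσ)
      have : (g (r + u) : ℚ) = g r := by rw [hg, hg, map_add, map_add, hu0, add_zero]
      exact_mod_cast this
    have hr00 : g r = 0 := by
      by_contra hne
      have := hmin _ hru (by omega)
      omega
    apply mem_latticeSpan
    apply hker _ hrτ
    have := hg r
    rw [hr00] at this
    have h3 : (d : ℚ) * f (toNQ N r) = 0 := by rw [← this]; simp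
    exact (mul_eq_zero.1 h3).resolve_left hdQ.ne'

/-- A lattice point of `τ` that represents the generator `n_{τ,σ} ∈ N(σ)` of the image of `τ` in
`N(σ)`, for a facet `σ` of `τ`. -/
def facetGenerator [Module.Finite ℤ N] {σ τ : PointedCone ℚ (NQ N)} (h : IsFacetOf σ τ) : N :=
  (exists_facetGenerator h).choose

theorem facetGenerator_spec [Module.Finite ℤ N] {σ τ : PointedCone ℚ (NQ N)}
    (h : IsFacetOf σ τ) : IsFacetGenerator σ τ (facetGenerator h) :=
  (exists_facetGenerator h).choose_spec

theorem exists_dual_of_linearIndepOn {s : Set (NQ N)} (hs : LinearIndepOn ℚ id s)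
    (g : NQ N → ℚ) : ∃ m : MQ N, ∀ b ∈ s, m b = g b := by
  refine ⟨(Module.Basis.extend hs).constr ℚ (fun i => g i), fun b hb => ?_⟩
  have hb' : b ∈ hs.extend (Set.subset_univ s) := hs.subset_extend _ hb
  have h := (Module.Basis.extend hs).constr_basis ℚ (fun i => g i) ⟨b, hb'⟩
  rwa [Module.Basis.extend_apply_self] at h

/-- The generators of a simplicial cone span faces. -/
theorem hull_singleton_isFaceOf {s : Set (NQ N)} (hs : LinearIndepOn ℚ id s) {b : NQ N}
    (hb : b ∈ s) : (PointedCone.hull ℚ {b}).IsFaceOf (PointedCone.hull ℚ s) := by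
  classical
  obtain ⟨f, hf⟩ := exists_dual_of_linearIndepOn hs (fun x => if x = b then 0 else 1)
  have key : ∀ x ∈ PointedCone.hull ℚ s, 0 ≤ f x ∧ (f x = 0 → x ∈ PointedCone.hull ℚ {b}) := by
    intro x hx
    induction hx using Submodule.span_induction with
    | mem x h =>
      rw [hf x h]
      by_cases hxb : x = b
      · subst hxb
        refine ⟨by simp, fun _ => PointedCone.subset_hull (Set.mem_singleton x)⟩
      · simp [hxb]
    | zero => exact ⟨by simp, fun _ => zero_mem _⟩
    | add x y _ _ hx hy =>
      rw [map_add]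
      exact ⟨add_nonneg hx.1 hy.1, fun h => add_mem (hx.2 (by linarith [hx.1, hy.1]))
        (hy.2 (by linarith [hx.1, hy.1]))⟩
    | smul r x _ hx =>
      have hr : f (r • x) = (r : ℚ) * f x := by
        change f ((r : ℚ) • x) = _
        rw [map_smul, smul_eq_mul]
      rw [hr]
      refine ⟨mul_nonneg r.2 hx.1, fun h => ?_⟩
      rcases mul_eq_zero.1 h with h | h
      · have : r = 0 := Subtype.ext h
        rw [this, zero_smul]; exact zero_mem _
      · exact Submodule.smul_mem _ r (hx.2 h)
  have hzero : ∀ x ∈ PointedCone.hull ℚ {b}, f x = 0 := by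
    intro x hx
    obtain ⟨c, rfl⟩ := Submodule.mem_span_singleton.1 (PointedCone.hull_le_span ℚ _ hx)
    rw [map_smul, hf b hb]; simp
  refine PointedCone.IsFaceOf.of_mem_of_add_mem_left
    (Submodule.span_mono (Set.singleton_subset_iff.2 hb)) ?_
  intro x y hx hy hxy
  have h0 := hzero _ hxy
  rw [map_add] at h0
  exact (key x hx).2 (by linarith [(key x hx).1, (key y hy).1])

theorem dim_hull_singleton {b : NQ N} (hb : b ≠ 0) : dim (PointedCone.hull ℚ {b}) = 1 := by
  have : linSpan (PointedCone.hull ℚ {b}) = Submodule.span ℚ {b} :=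
    le_antisymm (Submodule.span_le.2 (PointedCone.hull_le_span ℚ _))
      (Submodule.span_mono PointedCone.subset_hull)
  rw [dim, this, finrank_span_singleton hb]

/-- A face with the same dimension as the cone is the whole cone. -/
theorem eq_of_isFaceOf_of_dim_eq [Module.Finite ℤ N] {σ τ : PointedCone ℚ (NQ N)}
    (h : σ.IsFaceOf τ) (hd : dim σ = dim τ) : σ = τ := by
  refine le_antisymm h.le fun x hx => mem_face_of_mem_linSpan h hx ?_
  rw [Submodule.eq_of_le_of_finrank_eq (linSpan_mono h.le) hd]
  exact le_linSpan hx

end Cones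

/-! ### Fans, cycles and `ℚ`-Cartier divisors -/

/-- A fan in `N`: a finite nonempty collection of strongly convex rational polyhedral cones, closed
under taking faces, such that any two of its cones intersect in a common face. -/
structure Fan (N : Type*) [AddCommGroup N] where
  cones : Finset (PointedCone ℚ (NQ N))
  nonempty : cones.Nonempty
  rational : ∀ σ ∈ cones, IsRationalPolyhedral σ
  salient : ∀ σ ∈ cones, (σ : ConvexCone ℚ (NQ N)).Salient
  face_mem : ∀ σ ∈ cones, ∀ τ : PointedCone ℚ (NQ N), τ.IsFaceOf σ → τ ∈ cones
  inter_face : ∀ σ ∈ cones, ∀ τ ∈ cones, (σ ⊓ τ).IsFaceOf σ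

namespace Fan

variable {N : Type*} [AddCommGroup N] (F : Fan N)

/-- A fan is simplicial if each of its cones is generated by linearly independent vectors. -/
def IsSimplicial : Prop := ∀ σ ∈ F.cones, PointedCone.IsSimplicial σ

/-- Every cone of the fan is contained in a cone of the fan of dimension `n = rank N`; that is, all
maximal cones are full-dimensional. -/
def IsPure : Prop := ∀ σ ∈ F.cones, ∃ γ ∈ F.cones, σ ≤ γ ∧ dim γ = Module.finrank ℤ N

/-- The rays `ρ_1, …, ρ_r` of the fan. -/
abbrev Ray : Type _ := {ρ : F.cones // dim ρ.1 = 1}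

/-- The invariant cycles with rational coefficients, `Z_*(X)_ℚ`: the `ℚ`-vector space with basis
`[V(σ)]`, `σ` a cone of the fan. -/
abbrev Cycle : Type _ := F.cones →₀ ℚ

/-- The basis element `[V(σ)]`. -/
def V (σ : F.cones) : F.Cycle := Finsupp.single σ 1

/-- `Z_k(X)_ℚ ⊆ Z_*(X)_ℚ`: the span of the `[V(σ)]` with `dim σ = n - k`. -/
def Z (k : ℕ) : Submodule ℚ F.Cycle :=
  Finsupp.supported ℚ ℚ {σ : F.cones | dim σ.1 + k = Module.finrank ℤ N}

/-- The natural map `M_σ → M_τ` for `τ ⊆ σ`, where `M_σ = M_ℚ / M(σ)`. -/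
def restr {σ τ : PointedCone ℚ (NQ N)} (h : τ ≤ σ) : (MQ N ⧸ perp σ) →ₗ[ℚ] (MQ N ⧸ perp τ) :=
  Submodule.mapQ (perp σ) (perp τ) LinearMap.id (perp_anti h)

/-- The space of `ℚ`-Cartier divisors: families of local equations `m_σ ∈ M_σ = M_ℚ / M(σ)` such
that `m_σ` is sent to `m_τ` whenever `τ` is a face of `σ`. -/
def QCartier : Submodule ℚ (∀ σ : F.cones, MQ N ⧸ perp σ.1) where
  carrier := {m | ∀ (σ τ : F.cones) (h : τ.1.IsFaceOf σ.1), restr h.le (m σ) = m τ}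
  add_mem' := fun {a b} ha hb σ τ h => by
    rw [Pi.add_apply, Pi.add_apply, map_add, ha σ τ h, hb σ τ h]
  zero_mem' := fun σ τ h => by rw [Pi.zero_apply, Pi.zero_apply, map_zero]
  smul_mem' := fun c a ha σ τ h => by rw [Pi.smul_apply, Pi.smul_apply, map_smul, ha σ τ h]

theorem bot_isFaceOf {σ : PointedCone ℚ (NQ N)} (h : (σ : ConvexCone ℚ (NQ N)).Salient) :
    (⊥ : PointedCone ℚ (NQ N)).IsFaceOf σ := by
  refine PointedCone.IsFaceOf.of_mem_of_add_mem_left bot_le ?_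
  intro x y hx hy hxy
  by_contra hne
  have hxy0 : x + y = 0 := by simpa using hxy
  refine h x hx (by simpa using hne) ?_
  rw [neg_eq_of_add_eq_zero_right hxy0]
  exact hy

theorem dim_bot : dim (⊥ : PointedCone ℚ (NQ N)) = 0 := by
  have : linSpan (⊥ : PointedCone ℚ (NQ N)) = ⊥ := by
    rw [eq_bot_iff]
    exact Submodule.span_le.2 fun x hx => by simpa using hx
  rw [dim, this, finrank_bot]

theorem isFacetOf_ray (ρ : F.Ray) : IsFacetOf ⊥ ρ.1.1 :=
  ⟨bot_isFaceOf (F.salient _ ρ.1.2), by rw [dim_bot, ρ.2]⟩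

theorem isFaceOf_of_le {σ τ : F.cones} (h : τ.1 ≤ σ.1) : τ.1.IsFaceOf σ.1 := by
  have := F.inter_face _ σ.2 _ τ.2
  rwa [inf_eq_right.2 h] at this

variable [Module.Finite ℤ N]

/-- `v_ρ`, the first lattice point of `N` along the ray `ρ`. -/
def rayGenerator (ρ : F.Ray) : N := facetGenerator (F.isFacetOf_ray ρ)

/-- The pairing `M_τ → ℚ`, `m ↦ ⟨m, x⟩`, with a point `x` of `τ`. -/
def pairing (τ : PointedCone ℚ (NQ N)) (x : NQ N) (hx : x ∈ τ) : (MQ N ⧸ perp τ) →ₗ[ℚ] ℚ :=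
  (perp τ).liftQ (Module.Dual.eval ℚ (NQ N) x) fun _ hm => apply_eq_zero_of_mem_perp hm hx

/-- The cycle `[D] = ∑_ρ ⟨m_ρ, v_ρ⟩ [V(ρ)]` of a `ℚ`-Cartier divisor `D`. -/
def divisorCycle (D : F.QCartier) : F.Cycle :=
  ∑ ρ : F.Ray, pairing ρ.1.1 (toNQ N (F.rayGenerator ρ))
    (facetGenerator_spec (F.isFacetOf_ray ρ)).mem (D.1 ρ.1) • F.V ρ.1

/-- In a simplicial fan the rays of a cone `σ` are its extremal rays: every `v_ρ` with `ρ` a ray of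
`σ` is a positive multiple of one of the linearly independent generators, and conversely. -/
theorem exists_generators (hF : F.IsSimplicial) (σ : F.cones) :
    ∃ s : Set (NQ N), LinearIndepOn ℚ id s ∧ PointedCone.hull ℚ s = σ.1 ∧
      ∃ r : s → F.Ray, (∀ b, (r b).1.1 = PointedCone.hull ℚ {b.1}) ∧
        (∀ ρ : F.Ray, ρ.1.1 ≤ σ.1 → ∃ b, r b = ρ) ∧
        ∃ c : s → ℚ, (∀ b, 0 < c b) ∧ ∀ b, toNQ N (F.rayGenerator (r b)) = c b • b.1 := by
  obtain ⟨s, -, hs, hσ⟩ := hF _ σ.2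
  have hface : ∀ b : s, (PointedCone.hull ℚ {b.1}).IsFaceOf σ.1 := fun b =>
    hσ ▸ hull_singleton_isFaceOf hs b.2
  have hne : ∀ b : s, b.1 ≠ 0 := fun b => hs.ne_zero b.2
  let r : s → F.Ray := fun b =>
    ⟨⟨PointedCone.hull ℚ {b.1}, F.face_mem _ σ.2 _ (hface b)⟩, dim_hull_singleton (hne b)⟩
  refine ⟨s, hs, hσ, r, fun _ => rfl, ?_, ?_⟩
  · intro ρ hρ
    have hρσ : ρ.1.1.IsFaceOf (PointedCone.hull ℚ s) := hσ ▸ F.isFaceOf_of_le hρ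
    by_contra! hno
    -- a face of the cone containing no generator is zero
    have key : ∀ x ∈ PointedCone.hull ℚ s, x ∈ ρ.1.1 → x = 0 := by
      intro x hx
      induction hx using Submodule.span_induction with
      | mem x h =>
        intro hxρ
        exfalso
        refine hno ⟨x, h⟩ (Subtype.ext (Subtype.ext ?_))
        refine eq_of_isFaceOf_of_dim_eq ?_ ((dim_hull_singleton (hne ⟨x, h⟩)).trans ρ.2.symm)
        refine (PointedCone.IsFaceOf.isFaceOf_iff_le (hface ⟨x, h⟩) (hσ ▸ hρσ)).2 ?_
        exact Submodule.span_le.2 (Set.singleton_subset_iff.2 hxρ)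
      | zero => intro _; rfl
      | add x y hx' hy' hx hy =>
        intro h
        rw [hx (hρσ.mem_of_add_mem_left hx' hy' h), hy (hρσ.mem_of_add_mem_right hx' hy' h),
          add_zero]
      | smul q x hx' hx =>
        intro h
        change (q : ℚ) • x ∈ ρ.1.1 at h
        change (q : ℚ) • x = 0
        rcases q.2.eq_or_lt with hq | hq
        · rw [← hq, zero_smul]
        · have hx2 : x ∈ ρ.1.1 := by
            have := ρ.1.1.smul_mem (inv_nonneg.2 hq.le) h
            rwa [smul_smul, inv_mul_cancel₀ hq.ne', one_smul] at this
          rw [hx hx2, smul_zero]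
    have hbot : ρ.1.1 = ⊥ := by
      rw [eq_bot_iff]
      intro x hx
      simpa using key x (hρσ.le hx) hx
    have h1 := ρ.2
    rw [hbot, dim_bot] at h1
    omega
  · have hc : ∀ b : s, ∃ c : ℚ, 0 < c ∧ toNQ N (F.rayGenerator (r b)) = c • b.1 := by
      intro b
      have hspec := facetGenerator_spec (F.isFacetOf_ray (r b))
      have hmem : toNQ N (F.rayGenerator (r b)) ∈ PointedCone.hull ℚ {b.1} := hspec.mem
      obtain ⟨c, hc⟩ := Submodule.mem_span_singleton.1 hmem
      refine ⟨c, lt_of_le_of_ne c.2 fun h0 => ?_, hc.symm⟩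
      apply hspec.notMem
      apply mem_latticeSpan
      have : c = 0 := Subtype.ext h0.symm
      rw [this, zero_smul] at hc
      change toNQ N (F.rayGenerator (r b)) ∈ _
      rw [← hc]
      exact zero_mem _
    choose c hc0 hc1 using hc
    exact ⟨c, hc0, hc1⟩

theorem exists_localEquation (hF : F.IsSimplicial) (a : F.Ray → ℚ) (σ : F.cones) :
    ∃ m : MQ N, ∀ ρ : F.Ray, ρ.1.1 ≤ σ.1 → m (toNQ N (F.rayGenerator ρ)) = a ρ := by
  classical
  obtain ⟨s, hs, -, r, -, hr, c, hc0, hc⟩ := F.exists_generators hF σ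
  obtain ⟨m, hm⟩ := exists_dual_of_linearIndepOn hs
    (fun x => if h : x ∈ s then a (r ⟨x, h⟩) / c ⟨x, h⟩ else 0)
  refine ⟨m, fun ρ hρ => ?_⟩
  obtain ⟨b, rfl⟩ := hr ρ hρ
  have := (hc0 b).ne'
  rw [hc, map_smul, hm _ b.2, dif_pos b.2, smul_eq_mul]
  field_simp

theorem mem_perp_of_rays (hF : F.IsSimplicial) (σ : F.cones) (m : MQ N)
    (h : ∀ ρ : F.Ray, ρ.1.1 ≤ σ.1 → m (toNQ N (F.rayGenerator ρ)) = 0) : m ∈ perp σ.1 := by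
  obtain ⟨s, hs, hσ, r, hr', -, c, hc0, hc⟩ := F.exists_generators hF σ
  have hb : ∀ b ∈ s, m b = 0 := by
    intro b hb
    have h1 : (r ⟨b, hb⟩).1.1 ≤ σ.1 := by
      rw [hr', ← hσ]
      exact Submodule.span_mono (Set.singleton_subset_iff.2 hb)
    have h2 := h _ h1
    rw [hc, map_smul, smul_eq_mul] at h2
    exact (mul_eq_zero.1 h2).resolve_left (hc0 _).ne'
  have hle : linSpan σ.1 ≤ LinearMap.ker m := by
    rw [linSpan, ← hσ]
    refine Submodule.span_le.2 fun x hx => ?_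
    exact Submodule.span_le.2 (fun b hb' => hb b hb') (PointedCone.hull_le_span ℚ _ hx)
  exact (Submodule.mem_dualAnnihilator m).2 fun x hx => hle hx

theorem divisorCycle_apply (D : F.QCartier) (ρ : F.Ray) : F.divisorCycle D ρ.1 =
    pairing ρ.1.1 (toNQ N (F.rayGenerator ρ))
      (facetGenerator_spec (F.isFacetOf_ray ρ)).mem (D.1 ρ.1) := by
  classical
  rw [divisorCycle, Finsupp.finsetSum_apply, Finset.sum_eq_single ρ]
  · simp [V]
  · intro ρ' _ hne
    have : ρ'.1 ≠ ρ.1 := fun h => hne (Subtype.ext h)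
    simp [V, this]
  · simp

/-- On a simplicial fan each cycle `[V(ρ)]`, `ρ` a ray, is the cycle of exactly one `ℚ`-Cartier
divisor. -/
theorem existsUnique_rayDivisor (hF : F.IsSimplicial) (ρ : F.Ray) :
    ∃! D : F.QCartier, F.divisorCycle D = F.V ρ.1 := by
  classical
  choose m hm using F.exists_localEquation hF (Pi.single ρ 1)
  refine ⟨⟨fun σ => (perp σ.1).mkQ (m σ), ?_⟩, ?_, ?_⟩
  · intro σ τ h
    change (perp τ.1).mkQ (m σ) = (perp τ.1).mkQ (m τ)
    rw [← sub_eq_zero, ← map_sub, Submodule.mkQ_apply, Submodule.Quotient.mk_eq_zero]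
    refine F.mem_perp_of_rays hF τ _ fun ρ' h' => ?_
    rw [LinearMap.sub_apply, hm σ ρ' (h'.trans h.le), hm τ ρ' h', sub_self]
  · change ∑ ρ' : F.Ray, _ • F.V ρ'.1 = F.V ρ.1
    have : ∀ ρ' : F.Ray, m ρ'.1 (toNQ N (F.rayGenerator ρ')) = (Pi.single ρ 1 : F.Ray → ℚ) ρ' :=
      fun ρ' => hm ρ'.1 ρ' le_rfl
    rw [Finset.sum_eq_single ρ]
    · change m ρ.1 (toNQ N (F.rayGenerator ρ)) • F.V ρ.1 = _
      rw [this]; simp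
    · intro ρ' _ hne
      change m ρ'.1 (toNQ N (F.rayGenerator ρ')) • F.V ρ'.1 = _
      rw [this]; simp [hne]
    · simp
  · intro D hD
    refine Subtype.ext (funext fun σ => ?_)
    obtain ⟨d, hd⟩ := Submodule.mkQ_surjective _ (D.1 σ)
    change D.1 σ = (perp σ.1).mkQ (m σ)
    rw [← hd, ← sub_eq_zero, ← map_sub, Submodule.mkQ_apply, Submodule.Quotient.mk_eq_zero]
    refine F.mem_perp_of_rays hF σ _ fun ρ' h' => ?_
    have h1 := F.divisorCycle_apply D ρ'
    rw [hD, ← D.2 σ ρ'.1 (F.isFaceOf_of_le h'), ← hd] at h1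
    change F.V ρ.1 ρ'.1 = d (toNQ N (F.rayGenerator ρ')) at h1
    rw [LinearMap.sub_apply, hm σ ρ' h', ← h1, sub_eq_zero]
    rcases eq_or_ne ρ' ρ with rfl | hne
    · simp [V]
    · have h3 : ρ.1 ≠ ρ'.1 := fun h => hne (Subtype.ext h.symm)
      simp [V, hne, h3]

/-- On a simplicial fan, `D_ρ` is the `ℚ`-Cartier divisor with cycle `[V(ρ)]`. -/
def rayDivisor (hF : F.IsSimplicial) (ρ : F.Ray) : F.QCartier :=
  (F.existsUnique_rayDivisor hF ρ).choose

/-! ### The action of `ℚ`-Cartier divisors on cycles -/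

/-- A choice of complements for a fan: subspaces `Ψ(σ)` of `M_ℚ` complementary to `M(σ)`, with
`Ψ(τ) ⊆ Ψ(σ)` for `τ` a face of `σ`. -/
structure Complements where
  Ψ : F.cones → Submodule ℚ (MQ N)
  isCompl : ∀ σ : F.cones, IsCompl (perp σ.1) (Ψ σ)
  mono : ∀ σ τ : F.cones, τ.1.IsFaceOf σ.1 → Ψ τ ≤ Ψ σ

variable {F}

/-- The projection `π_σ : M_ℚ → M(σ)` along `Ψ(σ)`. -/
def Complements.proj (C : F.Complements) (σ : F.cones) : MQ N →ₗ[ℚ] perp σ.1 :=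
  (perp σ.1).projectionOnto (C.Ψ σ) (C.isCompl σ)

/-- The functional `M_τ → ℚ`, `m ↦ ⟨π_σ(m), n_{τ,σ}⟩`, for a facet `σ` of `τ`. -/
def Complements.facetPairing (C : F.Complements) (σ τ : F.cones) (h : IsFacetOf σ.1 τ.1) :
    (MQ N ⧸ perp τ.1) →ₗ[ℚ] ℚ :=
  (perp τ.1).liftQ
    ((Module.Dual.eval ℚ (NQ N) (toNQ N (facetGenerator h))) ∘ₗ (perp σ.1).subtype ∘ₗ C.proj σ)
    fun m hm => by
      have h1 : C.proj σ m = ⟨m, perp_anti h.face.le hm⟩ :=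
        Submodule.projectionOnto_apply_left (C.isCompl σ) ⟨m, perp_anti h.face.le hm⟩
      change (C.proj σ m : MQ N) (toNQ N (facetGenerator h)) = 0
      rw [h1]
      exact apply_eq_zero_of_mem_perp hm (facetGenerator_spec h).mem

open Classical in
/-- The action of a `ℚ`-Cartier divisor `D` with local equations `m_τ` on cycles:
`D · [V(σ)] = ∑_{τ → σ} ⟨π_σ(m_τ), n_{τ,σ}⟩ [V(τ)]`, the sum over the cones `τ` with facet `σ`.
For a simplicial fan this is multiplication by `D` in the ring `Z_*(X)_ℚ`, so that multiplication
by the power `D^k` is the `k`-th power of this endomorphism. -/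
def Complements.act (C : F.Complements) (D : F.QCartier) : Module.End ℚ F.Cycle :=
  Finsupp.linearCombination ℚ fun σ : F.cones =>
    ∑ τ : F.cones, if h : IsFacetOf σ.1 τ.1 then C.facetPairing σ τ h (D.1 τ) • F.V τ else 0

variable (F)

/-- The choice of complements defined by an inner product on `M_ℚ`: `Ψ(σ)` is the orthogonal
complement of `M(σ) = σ^⊥`. -/
def complementsOfInner (B : LinearMap.BilinForm ℚ (MQ N)) (hs : B.IsSymm)
    (hp : ∀ m, m ≠ 0 → 0 < B m m) : F.Complements where
  Ψ σ := B.orthogonal (perp σ.1)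
  isCompl σ := by
    refine (LinearMap.BilinForm.isCompl_orthogonal_iff_disjoint hs.isRefl).2 ?_
    rw [Submodule.disjoint_def]
    intro m hm hm'
    by_contra hne
    have h1 := hp m hne
    have h2 : B m m = 0 := hm' m hm
    linarith
  mono σ τ h := LinearMap.BilinForm.orthogonal_le (perp_anti h.le)

end Fan

/-! ### Generic inner products -/

/-- A set of symmetric `n × n` matrices over `ℚ` is Zariski-open if it is the locus where at least
one member of some family of polynomials in the matrix entries does not vanish. -/
def IsZariskiOpen {n : ℕ} (S : Set {A : Matrix (Fin n) (Fin n) ℚ // A.IsSymm}) : Prop :=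
  ∃ P : Set (MvPolynomial (Fin n × Fin n) ℚ),
    S = {A | ∃ p ∈ P, MvPolynomial.eval (fun ij => A.1 ij.1 ij.2) p ≠ 0}

/-- `p` holds for a generic inner product on the rational vector space `V`: after fixing a basis of
`V`, there is a nonempty Zariski-open set `S` of symmetric matrices such that `p` holds for the
inner product defined by any positive definite matrix in `S`.  (This does not depend on the basis;
the condition is imposed for all of them.) -/
def ForGenericInner (V : Type*) [AddCommGroup V] [Module ℚ V]
    (p : ∀ B : LinearMap.BilinForm ℚ V, B.IsSymm → (∀ m, m ≠ 0 → 0 < B m m) → Prop) : Prop :=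
  ∀ b : Module.Basis (Fin (Module.finrank ℚ V)) ℚ V,
    ∃ S : Set {A : Matrix (Fin (Module.finrank ℚ V)) (Fin (Module.finrank ℚ V)) ℚ // A.IsSymm},
      S.Nonempty ∧ IsZariskiOpen S ∧
        ∀ A ∈ S, ∀ (hs : (Matrix.toBilin b A.1).IsSymm)
          (hp : ∀ m, m ≠ 0 → 0 < Matrix.toBilin b A.1 m m), p (Matrix.toBilin b A.1) hs hp

end Toric

end

open scoped TensorProduct

noncomputable section

namespace Toric

/-! The coefficient of `ω^(n-2i) · x` at a face `τ` of a cone `γ` involves only the coefficients of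
`x` at faces of `τ`. So each full-dimensional `γ` can be treated separately: it suffices that the
block of the matrix of `ω^(n-2i)` from the `i`-dimensional to the `(n-i)`-dimensional faces of `γ`
has trivial kernel. By purity every cone is a face of some such `γ`.

For fixed `γ`, take the first lattice points `v_j` on its rays as a basis of `N_ℚ` and make the dual
basis orthonormal. Faces of `γ` are subsets `t` of the index set, and passing from `t` to `t ∪ {j}`
has coefficient `a_j · mult(t) / mult(t ∪ {j})`, where `mult(t)` is the index in `N_σ` of its
intersection with the lattice spanned by all the `v_i`. With `w_t = ∏_{i ∈ t} a_i / mult(t)`,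
non-zero because all `a_i` are, this is `w_{t ∪ j} / w_t`. Hence in the basis `w_t [V(t)]`, modulo
cones outside `γ`, `ω` sends `t` to the sum of the `t ∪ {j}`, and `ω^k` is `k!` times the inclusion
matrix of subsets (`actMatrix_pow_dualInner`). Inclusion–exclusion shows that inclusion of
`i`-subsets in `(n-i)`-subsets is injective for `2i ≤ n` (`eq_zero_of_sum_powersetCard_eq_zero`,
`eq_zero_of_actMatrix_pow_dualInner`).

Injectivity spreads to generic inner products: by Cramer's rule the matrix of the action is rational
in the inner product, so a left inverse of the block at the special inner product yields a
determinant, polynomial after clearing denominators, whose non-vanishing forces injectivity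
(`exists_polynomial_injective_on_faces`). The finitely many polynomials, over all `γ` and `i`, are
multiplied together. -/

/-! ### Injectivity of inclusion matrices of subsets -/

/-- A function on the `i`-subsets of a finite set vanishes if its sums over the `i`-subsets of all
subsets of codimension at most `i` vanish. -/
theorem eq_zero_of_sum_powersetCard_eq_zero {ι : Type*} [Fintype ι] [DecidableEq ι] (i : ℕ)
    (x : Finset ι → ℚ)
    (h : ∀ u : Finset ι, Fintype.card ι ≤ u.card + i → ∑ t ∈ u.powersetCard i, x t = 0)
    (t : Finset ι) (ht : t.card = i) : x t = 0 := by
  -- Inclusion–exclusion over `R ⊆ t`, with the hypothesis applied to `Rᶜ`, whose codimension is at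
  -- most `i`. After exchanging sums, the coefficient of `x u` is the alternating sum over subsets
  -- of `t \ u`, which is zero unless `t ⊆ u`, that is, `u = t`.
  have h1 : ∑ R ∈ t.powerset, (-1 : ℚ) ^ R.card * ∑ u ∈ Rᶜ.powersetCard i, x u = 0 := by
    refine Finset.sum_eq_zero fun R hR => ?_
    rw [h, mul_zero]
    have := Finset.card_le_card (Finset.mem_powerset.1 hR)
    have := Finset.card_add_card_compl R
    omega
  have h2 : ∀ R : Finset ι, ∑ u ∈ Rᶜ.powersetCard i, x u =
      ∑ u ∈ Finset.univ.powersetCard i, if Disjoint R u then x u else 0 := by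
    intro R
    rw [← Finset.sum_filter]
    refine Finset.sum_congr ?_ fun _ _ => rfl
    ext u
    simp [Finset.mem_powersetCard, Finset.subset_compl_iff_disjoint_left, and_comm]
  have h3 : ∀ u ∈ (Finset.univ : Finset ι).powersetCard i,
      ∑ R ∈ t.powerset, (-1 : ℚ) ^ R.card * (if Disjoint R u then x u else 0) =
        if u = t then x u else 0 := by
    intro u hu
    have hu' : u.card = i := (Finset.mem_powersetCard.1 hu).2
    have h4 : ∑ R ∈ t.powerset, (-1 : ℚ) ^ R.card * (if Disjoint R u then x u else 0) =
        (∑ R ∈ (t \ u).powerset, (-1 : ℚ) ^ R.card) * x u := by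
      have : (t \ u).powerset = t.powerset.filter fun R => Disjoint R u := by
        ext R
        simp [Finset.subset_sdiff]
      rw [this, Finset.sum_filter, Finset.sum_mul]
      refine Finset.sum_congr rfl fun R _ => ?_
      split_ifs <;> simp
    have h5 : (∑ R ∈ (t \ u).powerset, (-1 : ℚ) ^ R.card) = if t \ u = ∅ then 1 else 0 := by
      have := Finset.sum_powerset_neg_one_pow_card (x := t \ u)
      exact_mod_cast this
    rw [h4, h5]
    have h6 : t \ u = ∅ ↔ u = t := by
      rw [Finset.sdiff_eq_empty_iff_subset]
      exact ⟨fun hs => (Finset.eq_of_subset_of_card_le hs (by omega)).symm, fun he => he ▸ subset_rfl⟩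
    simp [h6]
  simp_rw [h2, Finset.mul_sum] at h1
  rw [Finset.sum_comm, Finset.sum_congr rfl h3, Finset.sum_ite_eq', if_pos] at h1
  · exact h1
  · simp [ht]

/-! ### Polynomials on symmetric matrices -/

/-- Finitely many polynomials, each nonzero at some symmetric matrix, are simultaneously nonzero
at some symmetric matrix. -/
theorem exists_isSymm_eval_prod_ne_zero {n : ℕ} {κ : Type*} (s : Finset κ)
    (p : κ → MvPolynomial (Fin n × Fin n) ℚ)
    (h : ∀ k ∈ s, ∃ A : Matrix (Fin n) (Fin n) ℚ, A.IsSymm ∧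
      MvPolynomial.eval (fun ij => A ij.1 ij.2) (p k) ≠ 0) :
    ∃ A : Matrix (Fin n) (Fin n) ℚ, A.IsSymm ∧
      MvPolynomial.eval (fun ij => A ij.1 ij.2) (∏ k ∈ s, p k) ≠ 0 := by
  -- Folding entries onto the upper triangle replaces symmetric matrices by arbitrary points in the
  -- remaining variables. There a product of non-zero polynomials is non-zero, and has a non-zero
  -- value because `ℚ` is infinite.
  let φ : Fin n × Fin n → Fin n × Fin n := fun ij => (min ij.1 ij.2, max ij.1 ij.2)
  have hφ : ∀ A : Matrix (Fin n) (Fin n) ℚ, A.IsSymm →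
      (fun ij : Fin n × Fin n => A ij.1 ij.2) ∘ φ = fun ij => A ij.1 ij.2 := by
    intro A hA
    funext ij
    rcases le_total ij.1 ij.2 with hij | hij
    · simp [φ, hij]
    · simpa [φ, hij] using hA.apply _ _
  have hne : ∏ k ∈ s, MvPolynomial.rename φ (p k) ≠ 0 := by
    refine Finset.prod_ne_zero_iff.2 fun k hk h0 => ?_
    obtain ⟨A, hA, hAk⟩ := h k hk
    apply hAk
    rw [← hφ A hA, ← MvPolynomial.eval_rename, h0, map_zero]
  obtain ⟨x, hx⟩ : ∃ x, MvPolynomial.eval x (∏ k ∈ s, MvPolynomial.rename φ (p k)) ≠ 0 := by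
    by_contra! hc
    exact hne (MvPolynomial.funext fun x => by rw [hc x, map_zero])
  refine ⟨Matrix.of fun i j => x (φ (i, j)), ?_, ?_⟩
  · ext i j
    simp [φ, min_comm, max_comm]
  · rw [← map_prod, MvPolynomial.eval_rename] at hx
    exact hx

/-! ### An index computation -/

/-- The index of `L` in `H + ℤ n`, where `k` is the order of `n` modulo `L + H`. -/
theorem relIndex_sup_zmultiples {G : Type*} [AddCommGroup G] (L H : AddSubgroup G) (n : G) (k : ℕ)
    (hk : ∀ m : ℤ, m • n ∈ L ⊔ H ↔ (k : ℤ) ∣ m) :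
    L.relIndex (H ⊔ AddSubgroup.zmultiples n) = L.relIndex H * k := by
  -- Pulled back along `m ↦ m • n`, the subgroup `L ⊔ H` becomes `kℤ`. The claim then follows from
  -- multiplicativity of the index along `L ≤ L ⊔ H ≤ L ⊔ H ⊔ ℤn`.
  have h1 : (L ⊔ H).relIndex (L ⊔ H ⊔ AddSubgroup.zmultiples n) = k := by
    rw [AddSubgroup.relIndex_sup_left]
    have h2 : (L ⊔ H).comap (zmultiplesHom G n) = AddSubgroup.zmultiples (k : ℤ) := by
      ext m
      rw [AddSubgroup.mem_comap, zmultiplesHom_apply, hk, Int.mem_zmultiples_iff]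
    have h3 : (zmultiplesHom G n).range = AddSubgroup.zmultiples n := by
      ext; simp [AddSubgroup.mem_zmultiples_iff]
    rw [← h3, ← AddSubgroup.index_comap, h2, Int.index_zmultiples, Int.natAbs_natCast]
  rw [← AddSubgroup.relIndex_sup_left (H ⊔ _) L, ← sup_assoc,
    ← AddSubgroup.relIndex_mul_relIndex L (L ⊔ H) _ le_sup_left le_sup_left, h1,
    AddSubgroup.relIndex_sup_left]

/-! ### Orthogonal projections as rational functions of the inner product -/

/-- The Gram system that determines an orthogonal projection. -/
theorem bilin_projectionOnto {V : Type*} [AddCommGroup V] [Module ℚ V]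
    (B : LinearMap.BilinForm ℚ V) {W : Submodule ℚ V} (h : IsCompl W (B.orthogonal W)) (m : V)
    {w : V} (hw : w ∈ W) : B w (W.projectionOnto _ h m) = B w m := by
  have h1 : m - W.projectionOnto _ h m ∈ B.orthogonal W := by
    rw [← Submodule.projectionOnto_apply_eq_zero_iff h, map_sub, sub_eq_zero,
      Submodule.projectionOnto_apply_left]
  have h2 : B w (m - W.projectionOnto _ h m) = 0 := h1 w hw
  rw [map_sub, sub_eq_zero] at h2
  exact h2.symm

/-- The value of a bilinear form as a polynomial in its matrix. -/
def bilinPolynomial {V : Type*} [AddCommGroup V] [Module ℚ V] {n : ℕ}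
    (b : Module.Basis (Fin n) ℚ V) (x y : V) : MvPolynomial (Fin n × Fin n) ℚ :=
  ∑ i, ∑ j, MvPolynomial.C (b.repr x i * b.repr y j) * MvPolynomial.X (i, j)

theorem eval_bilinPolynomial {V : Type*} [AddCommGroup V] [Module ℚ V] {n : ℕ}
    (b : Module.Basis (Fin n) ℚ V) (x y : V) (A : Matrix (Fin n) (Fin n) ℚ) :
    MvPolynomial.eval (fun ij => A ij.1 ij.2) (bilinPolynomial b x y) = Matrix.toBilin b A x y := by
  simp only [bilinPolynomial, map_sum, map_mul, MvPolynomial.eval_C, MvPolynomial.eval_X,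
    Matrix.toBilin_apply]
  exact Finset.sum_congr rfl fun i _ => Finset.sum_congr rfl fun j _ => by ring

/-- Orthogonal projections depend rationally on the inner product, with a denominator that does
not vanish on inner products. -/
theorem exists_polynomial_projectionOnto {V : Type*} [AddCommGroup V] [Module ℚ V]
    [FiniteDimensional ℚ V] {n : ℕ} (b : Module.Basis (Fin n) ℚ V) (W : Submodule ℚ V) (m : V)
    (f : V →ₗ[ℚ] ℚ) : ∃ p q : MvPolynomial (Fin n × Fin n) ℚ, ∀ A : Matrix (Fin n) (Fin n) ℚ,
      (∀ m, m ≠ 0 → 0 < Matrix.toBilin b A m m) →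
      MvPolynomial.eval (fun ij => A ij.1 ij.2) q ≠ 0 ∧
      ∀ h : IsCompl W ((Matrix.toBilin b A).orthogonal W),
        MvPolynomial.eval (fun ij => A ij.1 ij.2) q * f (W.projectionOnto _ h m) =
          MvPolynomial.eval (fun ij => A ij.1 ij.2) p := by
  classical
  let e := Module.finBasis ℚ W
  -- The coordinates `x` of the projection of `m` solve the Gram system `G x = v`; Cramer's rule
  -- `det G • x = adj(G) v` supplies both the denominator and the numerator.
  let G : Matrix (Fin (Module.finrank ℚ W)) (Fin (Module.finrank ℚ W))
      (MvPolynomial (Fin n × Fin n) ℚ) := Matrix.of fun i j => bilinPolynomial b (e i) (e j)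
  let v : Fin (Module.finrank ℚ W) → MvPolynomial (Fin n × Fin n) ℚ :=
    fun i => bilinPolynomial b (e i) m
  refine ⟨∑ j, (G.adjugate.mulVec v) j * MvPolynomial.C (f (e j)), G.det, fun A hp => ?_⟩
  set ev := MvPolynomial.eval (fun ij : Fin n × Fin n => A ij.1 ij.2) with hev
  have hG : ∀ i j, ev.mapMatrix G i j = Matrix.toBilin b A (e i) (e j) := fun i j =>
    eval_bilinPolynomial b _ _ A
  have hv : ∀ i, ev (v i) = Matrix.toBilin b A (e i) m := fun i => eval_bilinPolynomial b _ _ A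
  have hGx : ∀ x : Fin (Module.finrank ℚ W) → ℚ, ∀ i,
      (ev.mapMatrix G).mulVec x i = Matrix.toBilin b A (e i) (∑ j, x j • (e j : V)) := by
    intro x i
    rw [map_sum, Matrix.mulVec, dotProduct]
    refine Finset.sum_congr rfl fun j _ => ?_
    rw [hG, map_smul, smul_eq_mul, mul_comm]
  refine ⟨?_, fun h => ?_⟩
  -- A kernel vector of the evaluated Gram matrix would give a non-zero element of `W` whose square
  -- is zero.
  · rw [RingHom.map_det]
    intro h0
    obtain ⟨x, hx0, hx⟩ := Matrix.exists_mulVec_eq_zero_iff.2 h0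
    have h1 : (∑ j, x j • (e j : V)) ≠ 0 := by
      intro h2
      apply hx0
      have h3 : ∑ j, x j • e j = 0 := Subtype.ext (by simpa using h2)
      exact funext (Fintype.linearIndependent_iff.1 e.linearIndependent x h3)
    have h2 : ∀ y, Matrix.toBilin b A (∑ j, x j • (e j : V)) y =
        ∑ j, x j * Matrix.toBilin b A (e j) y := by
      intro y
      simp only [map_sum, map_smul, LinearMap.sum_apply, LinearMap.smul_apply, smul_eq_mul]
    have h3 := hp _ h1
    rw [h2] at h3
    simp only [← hGx, hx, Pi.zero_apply, mul_zero, Finset.sum_const_zero, lt_irrefl] at h3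
  · let x : Fin (Module.finrank ℚ W) → ℚ := fun j => e.repr (W.projectionOnto _ h m) j
    have hx : (W.projectionOnto _ h m : V) = ∑ j, x j • (e j : V) := by
      have := congrArg Subtype.val (e.sum_repr (W.projectionOnto _ h m))
      rw [Submodule.coe_sum] at this
      exact this.symm
    have hsys : (ev.mapMatrix G).mulVec x = fun i => ev (v i) := by
      funext i
      rw [hGx, ← hx, hv, bilin_projectionOnto _ h m (e i).2]
    have hcr : ev G.det • x = (ev.mapMatrix G.adjugate).mulVec (fun i => ev (v i)) := by
      rw [← hsys, RingHom.map_adjugate, Matrix.mulVec_mulVec, Matrix.adjugate_mul,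
        ← RingHom.map_det, Matrix.smul_mulVec, Matrix.one_mulVec]
    rw [hx, map_sum, Finset.mul_sum, map_sum]
    refine Finset.sum_congr rfl fun j _ => ?_
    have hj := congrFun hcr j
    rw [Pi.smul_apply, smul_eq_mul] at hj
    rw [map_smul, smul_eq_mul, ← mul_assoc, hj, map_mul, MvPolynomial.eval_C]
    congr 1
    exact (RingHom.map_mulVec ev _ _ j).symm

/-! ### The matrix of the action on cycles -/

namespace Fan

variable {N : Type*} [AddCommGroup N] [Module.Finite ℤ N] {F : Fan N}

open Classical in
/-- The matrix of the action of a `ℚ`-Cartier divisor on cycles; rows are indexed by sources. -/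
def Complements.actMatrix (C : F.Complements) (D : F.QCartier) : Matrix F.cones F.cones ℚ :=
  Matrix.of fun σ τ => if h : IsFacetOf σ.1 τ.1 then C.facetPairing σ τ h (D.1 τ) else 0

theorem Complements.act_apply (C : F.Complements) (D : F.QCartier) (x : F.Cycle) (τ : F.cones) :
    C.act D x τ = ∑ σ, x σ * C.actMatrix D σ τ := by
  classical
  rw [act, Finsupp.linearCombination_apply, Finsupp.sum_fintype _ _ (by simp),
    Finsupp.finsetSum_apply]
  refine Finset.sum_congr rfl fun σ _ => ?_
  rw [Finsupp.smul_apply, smul_eq_mul, Finsupp.finsetSum_apply, Finset.sum_eq_single τ]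
  · rw [actMatrix, Matrix.of_apply]
    split_ifs <;> simp [V]
  · intro τ' _ hne
    split_ifs <;> simp [V, hne]
  · simp

theorem Complements.act_pow_apply (C : F.Complements) (D : F.QCartier) (k : ℕ) (x : F.Cycle)
    (τ : F.cones) : (C.act D ^ k) x τ = ∑ σ, x σ * (C.actMatrix D ^ k) σ τ := by
  classical
  induction k generalizing τ with
  | zero => simp [Matrix.one_apply]
  | succ k ih =>
    rw [pow_succ', Module.End.mul_apply, C.act_apply, pow_succ]
    simp_rw [ih, Matrix.mul_apply, Finset.mul_sum, Finset.sum_mul, mul_assoc]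
    rw [Finset.sum_comm]

theorem Complements.isFacetOf_of_actMatrix_ne_zero {C : F.Complements} {D : F.QCartier}
    {σ τ : F.cones} (h : C.actMatrix D σ τ ≠ 0) : IsFacetOf σ.1 τ.1 := by
  by_contra hc
  exact h (by rw [actMatrix, Matrix.of_apply, dif_neg hc])

/-- A non-zero entry of the `k`-th power comes from a chain of `k` successive facet inclusions. This
locality allows the cones below a given `γ` to be treated on their own. -/
theorem Complements.le_and_dim_eq_of_actMatrix_pow_ne_zero {C : F.Complements} {D : F.QCartier}
    {k : ℕ} {σ τ : F.cones} (h : (C.actMatrix D ^ k) σ τ ≠ 0) :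
    σ.1 ≤ τ.1 ∧ dim τ.1 = dim σ.1 + k := by
  classical
  induction k generalizing τ with
  | zero =>
    have : σ = τ := by
      by_contra hne
      exact h (by rw [pow_zero, Matrix.one_apply_ne hne])
    simp [this]
  | succ k ih =>
    rw [pow_succ, Matrix.mul_apply] at h
    obtain ⟨υ, -, hυ⟩ := Finset.exists_ne_zero_of_sum_ne_zero h
    have h1 := ih (left_ne_zero_of_mul hυ)
    have h2 := isFacetOf_of_actMatrix_ne_zero (right_ne_zero_of_mul hυ)
    exact ⟨h1.1.trans h2.face.le, by rw [h2.dim_eq, h1.2, add_assoc]⟩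

theorem Complements.mapsTo_act_pow (C : F.Complements) (D : F.QCartier) {i j k : ℕ}
    (h : i = j + k) : Set.MapsTo (C.act D ^ k) (F.Z i) (F.Z j) := by
  intro x hx
  refine (Finsupp.mem_supported _ _).2 fun τ hτ => ?_
  have hτ' := Finsupp.mem_support_iff.1 hτ
  rw [C.act_pow_apply] at hτ'
  obtain ⟨σ, -, hσ⟩ := Finset.exists_ne_zero_of_sum_ne_zero hτ'
  have h1 := (Finsupp.mem_supported _ _).1 hx
    (Finsupp.mem_support_iff.2 (left_ne_zero_of_mul hσ))
  have h2 := (le_and_dim_eq_of_actMatrix_pow_ne_zero (right_ne_zero_of_mul hσ)).2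
  simp only [Set.mem_ofPred_eq] at h1 ⊢
  omega

/-- The matrix of the action depends rationally on the inner product. -/
theorem exists_polynomial_actMatrix [Module.Free ℤ N] (D : F.QCartier) {n : ℕ}
    (b : Module.Basis (Fin n) ℚ (MQ N)) :
    ∃ (P : Matrix F.cones F.cones (MvPolynomial (Fin n × Fin n) ℚ))
      (q : MvPolynomial (Fin n × Fin n) ℚ), ∀ (A : Matrix (Fin n) (Fin n) ℚ)
      (hs : (Matrix.toBilin b A).IsSymm) (hp : ∀ m, m ≠ 0 → 0 < Matrix.toBilin b A m m),
      MvPolynomial.eval (fun ij => A ij.1 ij.2) q ≠ 0 ∧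
      (MvPolynomial.eval (fun ij => A ij.1 ij.2)).mapMatrix P =
        MvPolynomial.eval (fun ij => A ij.1 ij.2) q •
          (F.complementsOfInner (Matrix.toBilin b A) hs hp).actMatrix D := by
  classical
  have key : ∀ σ τ : F.cones, ∃ p q : MvPolynomial (Fin n × Fin n) ℚ,
      ∀ (A : Matrix (Fin n) (Fin n) ℚ)
      (hs : (Matrix.toBilin b A).IsSymm) (hp : ∀ m, m ≠ 0 → 0 < Matrix.toBilin b A m m),
      MvPolynomial.eval (fun ij => A ij.1 ij.2) q ≠ 0 ∧
      MvPolynomial.eval (fun ij => A ij.1 ij.2) q *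
        (F.complementsOfInner (Matrix.toBilin b A) hs hp).actMatrix D σ τ =
        MvPolynomial.eval (fun ij => A ij.1 ij.2) p := by
    intro σ τ
    by_cases h : IsFacetOf σ.1 τ.1
    · obtain ⟨d, hd⟩ := Submodule.mkQ_surjective _ (D.1 τ)
      obtain ⟨p, q, hpq⟩ := exists_polynomial_projectionOnto b (perp σ.1) d
        (Module.Dual.eval ℚ (NQ N) (toNQ N (facetGenerator h)))
      refine ⟨p, q, fun A hs hp => ⟨(hpq A hp).1, ?_⟩⟩
      rw [Complements.actMatrix, Matrix.of_apply, dif_pos h, ← hd]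
      exact (hpq A hp).2 _
    · refine ⟨0, 1, fun A hs hp => ?_⟩
      rw [Complements.actMatrix, Matrix.of_apply, dif_neg h]
      simp
  choose p q hpq using key
  -- The common denominator is the product of the denominators of all entries, so each numerator is
  -- multiplied by the denominators of the other entries.
  refine ⟨Matrix.of fun σ τ => p σ τ * ∏ x ∈ Finset.univ.erase (σ, τ), q x.1 x.2,
    ∏ x : F.cones × F.cones, q x.1 x.2, fun A hs hp => ⟨?_, ?_⟩⟩
  · rw [map_prod]
    exact Finset.prod_ne_zero_iff.2 fun x _ => (hpq x.1 x.2 A hs hp).1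
  · ext σ τ
    rw [RingHom.mapMatrix_apply, Matrix.map_apply, Matrix.of_apply, Matrix.smul_apply, smul_eq_mul,
      map_mul, ← (hpq σ τ A hs hp).2, ← Finset.mul_prod_erase _ _ (Finset.mem_univ (σ, τ)), map_mul]
    ring

end Fan

/-! ### Faces of a simplicial cone as subsets of a basis -/

section BasisCone

variable {N : Type*} [AddCommGroup N] {ι : Type*} [Fintype ι]

/-- The cone generated by the members of a basis that are indexed by `t`. -/
def basisCone (e : Module.Basis ι ℚ (NQ N)) (t : Finset ι) : PointedCone ℚ (NQ N) :=
  PointedCone.hull ℚ (e '' t)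

variable (e : Module.Basis ι ℚ (NQ N))

/-- In the coordinates of the basis the cone is a coordinate orthant; this reduces inclusions and
faces to subsets of `ι`. -/
theorem mem_basisCone_iff {t : Finset ι} {x : NQ N} :
    x ∈ basisCone e t ↔ ∀ i, 0 ≤ e.repr x i ∧ (i ∉ t → e.repr x i = 0) := by
  classical
  constructor
  · intro hx
    induction hx using Submodule.span_induction with
    | mem x h =>
      obtain ⟨j, hj, rfl⟩ := h
      intro i
      rw [e.repr_self, Finsupp.single_apply]
      refine ⟨by split_ifs <;> simp, fun hi => if_neg ?_⟩
      rintro rfl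
      exact hi hj
    | zero => simp
    | add x y _ _ hx hy =>
      intro i
      rw [map_add, Finsupp.add_apply]
      exact ⟨add_nonneg (hx i).1 (hy i).1, fun hi => by rw [(hx i).2 hi, (hy i).2 hi, add_zero]⟩
    | smul r x _ hx =>
      intro i
      have hr : e.repr (r • x) i = (r : ℚ) * e.repr x i := by
        change e.repr ((r : ℚ) • x) i = _
        rw [map_smul, Finsupp.smul_apply, smul_eq_mul]
      rw [hr]
      exact ⟨mul_nonneg r.2 (hx i).1, fun hi => by rw [(hx i).2 hi, mul_zero]⟩
  · intro h
    rw [← e.sum_repr x]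
    refine Submodule.sum_mem _ fun i _ => ?_
    by_cases hi : i ∈ t
    · exact (basisCone e t).smul_mem (h i).1 (PointedCone.subset_hull ⟨i, hi, rfl⟩)
    · rw [(h i).2 hi, zero_smul]
      exact zero_mem _

theorem basis_mem_basisCone_iff {t : Finset ι} {i : ι} : e i ∈ basisCone e t ↔ i ∈ t := by
  classical
  refine ⟨fun h => ?_, fun h => PointedCone.subset_hull ⟨i, h, rfl⟩⟩
  by_contra hi
  have := ((mem_basisCone_iff e).1 h i).2 hi
  simp at this

theorem basisCone_le_iff {t u : Finset ι} : basisCone e t ≤ basisCone e u ↔ t ⊆ u :=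
  ⟨fun h _ hi => (basis_mem_basisCone_iff e).1 (h ((basis_mem_basisCone_iff e).2 hi)),
    fun h => Submodule.span_mono (Set.image_mono h)⟩

theorem basisCone_injective : Function.Injective (basisCone e) := fun _ _ h =>
  subset_antisymm ((basisCone_le_iff e).1 h.le) ((basisCone_le_iff e).1 h.ge)

theorem basisCone_isFaceOf {t u : Finset ι} (h : t ⊆ u) :
    (basisCone e t).IsFaceOf (basisCone e u) := by
  refine PointedCone.IsFaceOf.of_mem_of_add_mem_left ((basisCone_le_iff e).2 h) ?_
  intro x y hx hy hxy
  rw [mem_basisCone_iff] at hx hy hxy ⊢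
  intro i
  refine ⟨(hx i).1, fun hi => ?_⟩
  have := (hxy i).2 hi
  rw [map_add, Finsupp.add_apply] at this
  linarith [(hx i).1, (hy i).1]

/-- A face contains every summand `e.repr x i • e i` of each of its points `x`, hence, after
division by a positive coordinate, every basis vector occurring in `x`. -/
theorem exists_eq_basisCone_of_isFaceOf {σ : PointedCone ℚ (NQ N)} {u : Finset ι}
    (h : σ.IsFaceOf (basisCone e u)) : ∃ t ⊆ u, σ = basisCone e t := by
  classical
  refine ⟨u.filter fun i => e i ∈ σ, Finset.filter_subset _ _, le_antisymm (fun x hx => ?_) ?_⟩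
  · have hxu := (mem_basisCone_iff e).1 (h.le hx)
    rw [mem_basisCone_iff]
    refine fun i => ⟨(hxu i).1, fun hi => ?_⟩
    by_contra hne
    have hpos := lt_of_le_of_ne (hxu i).1 (Ne.symm hne)
    have hiu : i ∈ u := by
      by_contra hc
      exact hne ((hxu i).2 hc)
    refine hi (Finset.mem_filter.2 ⟨hiu, ?_⟩)
    have h1 : e.repr x i • e i ∈ σ := by
      have hs := h.mem_of_sum_mem (f := fun i => e.repr x i • e i) (fun k => ?_)
        (by rwa [e.sum_repr x]) i
      · exact hs
      · by_cases hk : k ∈ u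
        · exact (basisCone e u).smul_mem (hxu k).1 ((basis_mem_basisCone_iff e).2 hk)
        · rw [(hxu k).2 hk, zero_smul]
          exact zero_mem _
    have h2 := σ.smul_mem (inv_nonneg.2 hpos.le) h1
    rwa [smul_smul, inv_mul_cancel₀ hne, one_smul] at h2
  · refine Submodule.span_le.2 ?_
    rintro _ ⟨i, hi, rfl⟩
    exact (Finset.mem_filter.1 hi).2

omit [Fintype ι] in
theorem linSpan_basisCone (t : Finset ι) :
    linSpan (basisCone e t) = Submodule.span ℚ (e '' t) :=
  le_antisymm (Submodule.span_le.2 (PointedCone.hull_le_span ℚ _))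
    (Submodule.span_mono PointedCone.subset_hull)

omit [Fintype ι] in
theorem mem_linSpan_basisCone_iff {t : Finset ι} {x : NQ N} :
    x ∈ linSpan (basisCone e t) ↔ ∀ i, i ∉ t → e.repr x i = 0 := by
  rw [linSpan_basisCone, e.mem_span_image]
  refine ⟨fun h i hi => ?_, fun h i hi => ?_⟩
  · by_contra hne
    exact hi (h (Finsupp.mem_support_iff.2 hne))
  · by_contra hne
    exact Finsupp.mem_support_iff.1 hi (h i hne)

omit [Fintype ι] in
theorem dim_basisCone (t : Finset ι) : dim (basisCone e t) = t.card := by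
  classical
  rw [dim, linSpan_basisCone, ← Finset.coe_image, finrank_span_finset_eq_card,
    Finset.card_image_of_injective _ e.injective]
  rw [Finset.coe_image]
  exact (e.linearIndependent.linearIndepOn_id.mono (Set.image_subset_range _ _))

theorem isFacetOf_basisCone_insert [DecidableEq ι] {t : Finset ι} {j : ι} (hj : j ∉ t) :
    IsFacetOf (basisCone e t) (basisCone e (insert j t)) :=
  ⟨basisCone_isFaceOf e (Finset.subset_insert j t), by
    rw [dim_basisCone, dim_basisCone, Finset.card_insert_of_notMem hj]⟩

omit [Fintype ι] in
theorem mem_latticeSpan_basisCone_iff {t : Finset ι} {x : N} :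
    x ∈ latticeSpan (basisCone e t) ↔ ∀ i, i ∉ t → e.repr (toNQ N x) i = 0 := by
  rw [← mem_linSpan_basisCone_iff]
  exact ⟨toNQ_mem_linSpan, mem_latticeSpan⟩

/-- A free module is flat, so `ℤ ↪ ℚ` stays injective after tensoring with `N`. -/
theorem toNQ_injective [Module.Free ℤ N] : Function.Injective (toNQ N) := by
  have h := Module.Flat.rTensor_preserves_injective_linearMap (M := N)
    (Algebra.linearMap ℤ ℚ) Int.cast_injective
  have h2 := h.comp (TensorProduct.lid ℤ N).symm.injective
  convert h2 using 1
  funext x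
  simp [toNQ]
  rfl

/-! ### Multiplicities of the faces -/

/-- The multiplicity of the cone generated by the basis vectors with index in `t`. -/
def multiplicity (e : Module.Basis ι ℚ (NQ N)) (v : ι → N) (t : Finset ι) : ℕ :=
  (AddSubgroup.closure (Set.range v)).relIndex (latticeSpan (basisCone e t)).toAddSubgroup

variable {e} {v : ι → N}

/-- The image of the facet generator along the new basis vector has the ratio of the
multiplicities as its coordinate. -/
theorem exists_multiplicity_insert [DecidableEq ι] (hv : ∀ i, e i = toNQ N (v i))
    {t : Finset ι} {j : ι} (hj : j ∉ t) {n : N}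
    (hn : IsFacetGenerator (basisCone e t) (basisCone e (insert j t)) n) :
    ∃ k : ℕ, 0 < k ∧ k * e.repr (toNQ N n) j = 1 ∧
      multiplicity e v (insert j t) = multiplicity e v t * k := by
  -- Modulo `N_σ` the vector `v j` is `k` times the generator `n`; comparing `j`-th coordinates,
  -- that of `n` is `1 / k`.
  obtain ⟨k, hk⟩ := hn.generates (v j)
    (by rw [← hv]; exact (basis_mem_basisCone_iff e).2 (Finset.mem_insert_self j t))
  have hkn : k * e.repr (toNQ N n) j = 1 := by
    have := (mem_latticeSpan_basisCone_iff e).1 hk j hj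
    rw [map_sub, map_nsmul, map_sub, map_nsmul, ← hv, e.repr_self, Finsupp.sub_apply,
      Finsupp.smul_apply, Finsupp.single_eq_same, nsmul_eq_mul] at this
    linarith
  have hk0 : 0 < k := by
    rcases Nat.eq_zero_or_pos k with rfl | h
    · simp at hkn
    · exact h
  refine ⟨k, hk0, hkn, ?_⟩
  have hH : (latticeSpan (basisCone e (insert j t))).toAddSubgroup =
      (latticeSpan (basisCone e t)).toAddSubgroup ⊔ AddSubgroup.zmultiples n := by
    apply le_antisymm
    · intro x hx
      change x ∈ latticeSpan _ at hx
      induction hx using Submodule.span_induction with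
      | mem x h =>
        obtain ⟨l, hl⟩ := hn.generates x h
        rw [← sub_add_cancel x (l • n)]
        exact AddSubgroup.add_mem_sup hl (nsmul_mem (AddSubgroup.mem_zmultiples n) l)
      | zero => exact zero_mem _
      | add x y _ _ hx hy => exact add_mem hx hy
      | smul r x _ hx => exact zsmul_mem hx r
    · refine sup_le ?_ ((AddSubgroup.zmultiples_le_of_mem (Submodule.subset_span hn.mem)))
      have hle : latticeSpan (basisCone e t) ≤ latticeSpan (basisCone e (insert j t)) :=
        Submodule.span_mono fun y hy => (basisCone_le_iff e).2 (Finset.subset_insert j t) hy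
      exact fun x hx => hle hx
  -- Integrality of the `j`-th coordinate on the lattice of the `v i` shows that `m • n` lies in
  -- this lattice plus `N_σ` only if `m / k` is an integer. So `n` has order exactly `k` in the
  -- quotient.
  have hL : ∀ x ∈ AddSubgroup.closure (Set.range v), ∃ z : ℤ, e.repr (toNQ N x) j = z := by
    intro x hx
    induction hx using AddSubgroup.closure_induction with
    | mem x h =>
      obtain ⟨i, rfl⟩ := h
      rw [← hv, e.repr_self, Finsupp.single_apply]
      exact ⟨if i = j then 1 else 0, by split_ifs <;> simp⟩
    | zero => exact ⟨0, by simp⟩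
    | add x y _ _ hx hy =>
      obtain ⟨p, hp⟩ := hx
      obtain ⟨q, hq⟩ := hy
      exact ⟨p + q, by simp [hp, hq]⟩
    | neg x _ hx =>
      obtain ⟨p, hp⟩ := hx
      exact ⟨-p, by simp [hp]⟩
  rw [multiplicity, hH]
  refine relIndex_sup_zmultiples _ _ n k fun m => ⟨fun hm => ?_, ?_⟩
  · obtain ⟨l, hl, x, hx, hlx⟩ := AddSubgroup.mem_sup.1 hm
    obtain ⟨z, hz⟩ := hL l hl
    refine ⟨z, ?_⟩
    have h1 := congrArg (fun y => e.repr (toNQ N y) j) hlx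
    have h2 := (mem_latticeSpan_basisCone_iff e).1 hx j hj
    simp only [map_add, map_zsmul, Finsupp.add_apply, Finsupp.smul_apply, hz, h2, add_zero,
      zsmul_eq_mul] at h1
    have h3 : (m : ℚ) = k * z := by rw [h1]; linear_combination (-(m : ℚ)) * hkn
    exact_mod_cast h3
  · rintro ⟨c, rfl⟩
    rw [mul_comm, mul_smul]
    refine zsmul_mem ?_ c
    have h1 : (k : ℤ) • n = v j + -(v j - k • n) := by
      rw [natCast_zsmul]; abel
    rw [h1]
    exact AddSubgroup.add_mem_sup (AddSubgroup.subset_closure ⟨j, rfl⟩) (neg_mem hk)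

/-- Since `relIndex` takes the value `0` on infinite index, this expresses finiteness of the index.
It holds because the zero cone has trivial lattice and each further ray multiplies the index by a
positive `k`. -/
theorem multiplicity_pos [Module.Free ℤ N] [Module.Finite ℤ N] [DecidableEq ι]
    (hv : ∀ i, e i = toNQ N (v i)) (t : Finset ι) : 0 < multiplicity e v t := by
  induction t using Finset.induction_on with
  | empty =>
    have : (latticeSpan (basisCone e ∅)).toAddSubgroup = ⊥ := by
      rw [eq_bot_iff]
      intro x hx
      have h1 := (mem_latticeSpan_basisCone_iff e).1 hx
      have h2 : toNQ N x = 0 := e.repr.injective (Finsupp.ext fun i => by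
        rw [h1 i (Finset.notMem_empty i), map_zero, Finsupp.zero_apply])
      exact toNQ_injective (h2.trans (map_zero _).symm)
    rw [multiplicity, this]
    simp
  | insert j t hj ih =>
    obtain ⟨k, hk, -, h⟩ := exists_multiplicity_insert hv hj
      (facetGenerator_spec (isFacetOf_basisCone_insert e hj))
    rw [h]
    exact Nat.mul_pos ih hk

end BasisCone

/-! ### The inner product attached to a basis -/

section CoordinateInner

variable {V : Type*} [AddCommGroup V] [Module ℚ V] {ι : Type*} [Fintype ι]

/-- The inner product on the dual space for which the dual basis of `e` is orthonormal. -/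
def dualInner (e : Module.Basis ι ℚ V) : LinearMap.BilinForm ℚ (Module.Dual ℚ V) :=
  LinearMap.mk₂ ℚ (fun m m' => ∑ i, m (e i) * m' (e i))
    (fun m m' m'' => by simp [add_mul, Finset.sum_add_distrib])
    (fun c m m' => by simp [Finset.mul_sum, mul_assoc])
    (fun m m' m'' => by simp [mul_add, Finset.sum_add_distrib])
    (fun c m m' => by simp [Finset.mul_sum, mul_left_comm])

theorem dualInner_apply (e : Module.Basis ι ℚ V) (m m' : Module.Dual ℚ V) :
    dualInner e m m' = ∑ i, m (e i) * m' (e i) := rfl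

theorem dualInner_isSymm (e : Module.Basis ι ℚ V) : (dualInner e).IsSymm :=
  ⟨fun m m' => by simp [dualInner_apply, mul_comm]⟩

theorem dualInner_pos (e : Module.Basis ι ℚ V) (m : Module.Dual ℚ V) (hm : m ≠ 0) :
    0 < dualInner e m m := by
  rw [dualInner_apply]
  have h0 : ∀ i ∈ Finset.univ, 0 ≤ m (e i) * m (e i) := fun i _ => mul_self_nonneg _
  refine lt_of_le_of_ne (Finset.sum_nonneg h0) fun h => hm (e.ext fun i => ?_)
  exact mul_self_eq_zero.1 ((Finset.sum_eq_zero_iff_of_nonneg h0).1 h.symm i (Finset.mem_univ i))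

end CoordinateInner

/-! ### Ray bases and local equations -/

namespace Fan

variable {N : Type*} [AddCommGroup N] [Module.Finite ℤ N] {F : Fan N}

/-- The rays of a full-dimensional simplicial cone form a basis. -/
theorem exists_rayBasis [Module.Free ℤ N] (hF : F.IsSimplicial) (γ : F.cones)
    (hγ : dim γ.1 = Module.finrank ℤ N) :
    ∃ (ι : Type) (_ : Fintype ι) (e : Module.Basis ι ℚ (NQ N)) (r : ι → F.Ray),
      Fintype.card ι = Module.finrank ℤ N ∧ γ.1 = basisCone e Finset.univ ∧
      ∀ i, e i = toNQ N (F.rayGenerator (r i)) ∧ (r i).1.1 = basisCone e {i} := by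
  classical
  obtain ⟨s, hs, hsγ, r, hr, -, c, hc0, hc⟩ := F.exists_generators hF γ
  have hfin : Module.finrank ℚ (NQ N) = Module.finrank ℤ N := Module.finrank_baseChange
  have hspan : linSpan γ.1 = ⊤ := Submodule.eq_top_of_finrank_eq (by rw [hfin]; exact hγ)
  -- The generators supplied by simpliciality are rescaled to first lattice points, which changes
  -- neither their independence nor the cones they span.
  have hli : LinearIndependent ℚ (fun b : s => c b • b.1) := by
    have h1 : LinearIndependent ℚ (fun b : s => b.1) := hs
    exact h1.units_smul fun b => Units.mk0 (c b) (hc0 b).ne'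
  have hhull : ∀ b : s, PointedCone.hull ℚ {c b • b.1} = PointedCone.hull ℚ {b.1} := by
    intro b
    apply le_antisymm
    · refine Submodule.span_le.2 (Set.singleton_subset_iff.2 ?_)
      exact (PointedCone.hull ℚ {b.1}).smul_mem (hc0 b).le
        (PointedCone.subset_hull (Set.mem_singleton _))
    · refine Submodule.span_le.2 (Set.singleton_subset_iff.2 ?_)
      have h1 := (PointedCone.hull ℚ {c b • b.1}).smul_mem (inv_nonneg.2 (hc0 b).le)
        (PointedCone.subset_hull (Set.mem_singleton _))
      rwa [smul_smul, inv_mul_cancel₀ (hc0 b).ne', one_smul] at h1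
  have hrange : PointedCone.hull ℚ (Set.range fun b : s => c b • b.1) = γ.1 := by
    rw [← hsγ]
    apply le_antisymm
    · refine Submodule.span_le.2 ?_
      rintro _ ⟨b, rfl⟩
      exact (PointedCone.hull ℚ s).smul_mem (hc0 b).le (PointedCone.subset_hull b.2)
    · refine Submodule.span_le.2 fun b hb => ?_
      have h1 : b ∈ PointedCone.hull ℚ {c ⟨b, hb⟩ • b} := by
        rw [hhull ⟨b, hb⟩]
        exact PointedCone.subset_hull (Set.mem_singleton _)
      have h2 : ({c ⟨b, hb⟩ • b} : Set (NQ N)) ⊆ Set.range fun b : s => c b • b.1 :=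
        Set.singleton_subset_iff.2 ⟨⟨b, hb⟩, rfl⟩
      exact Submodule.span_mono h2 h1
  have htop : ⊤ ≤ Submodule.span ℚ (Set.range fun b : s => c b • b.1) := by
    rw [← hspan, linSpan, ← hrange]
    exact Submodule.span_le.2 (PointedCone.hull_le_span ℚ _)
  let e₀ := Module.Basis.mk hli htop
  have : Finite s := Module.Finite.finite_basis e₀
  let f := Finite.equivFin s
  have he : ∀ i, e₀.reindex f i = c (f.symm i) • (f.symm i).1 := fun i => by
    rw [Module.Basis.reindex_apply, Module.Basis.mk_apply]
  refine ⟨Fin (Nat.card s), inferInstance, e₀.reindex f, fun i => r (f.symm i), ?_, ?_, ?_⟩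
  · rw [← hfin, Module.finrank_eq_card_basis (e₀.reindex f)]
  · rw [← hrange, basisCone, Finset.coe_univ, Set.image_univ, Module.Basis.range_reindex,
      Module.Basis.coe_mk]
  · intro i
    refine ⟨by rw [he, hc], ?_⟩
    rw [hr, basisCone, Finset.coe_singleton, Set.image_singleton, he, hhull]

/-- Local equations of `∑ a_ρ D_ρ` take the value `a_ρ` on the generator of `ρ`. -/
theorem apply_rayGenerator_of_mkQ_eq (hF : F.IsSimplicial) (a : F.Ray → ℚ) {τ : F.cones}
    {d : MQ N} (hd : (perp τ.1).mkQ d = (∑ ρ, a ρ • F.rayDivisor hF ρ : F.QCartier).1 τ)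
    {ρ : F.Ray} (hρ : ρ.1.1 ≤ τ.1) : d (toNQ N (F.rayGenerator ρ)) = a ρ := by
  classical
  have h1 : ∀ ρ' : F.Ray, pairing ρ.1.1 (toNQ N (F.rayGenerator ρ))
      (facetGenerator_spec (F.isFacetOf_ray ρ)).mem ((F.rayDivisor hF ρ').1 ρ.1) =
        if ρ' = ρ then 1 else 0 := by
    intro ρ'
    have h : F.divisorCycle (F.rayDivisor hF ρ') = F.V ρ'.1 :=
      (F.existsUnique_rayDivisor hF ρ').choose_spec.1
    rw [← F.divisorCycle_apply, h, V, Finsupp.single_apply]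
    simp only [Subtype.ext_iff]
  -- Compatibility of local equations moves the evaluation from `τ` to the ray `ρ`, where the
  -- divisors `D_ρ'` pair with `v_ρ` as Kronecker deltas.
  have h2 := (∑ ρ, a ρ • F.rayDivisor hF ρ : F.QCartier).2 τ ρ.1 (F.isFaceOf_of_le hρ)
  rw [← hd] at h2
  have h3 : d (toNQ N (F.rayGenerator ρ)) = pairing ρ.1.1 (toNQ N (F.rayGenerator ρ))
      (facetGenerator_spec (F.isFacetOf_ray ρ)).mem
        ((∑ ρ, a ρ • F.rayDivisor hF ρ : F.QCartier).1 ρ.1) := by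
    rw [← h2]; rfl
  have h4 : (∑ ρ, a ρ • F.rayDivisor hF ρ : F.QCartier).1 ρ.1 =
      ∑ ρ', a ρ' • (F.rayDivisor hF ρ').1 ρ.1 := by
    rw [Submodule.coe_sum, Finset.sum_apply]; rfl
  rw [h3, h4, map_sum]
  simp [h1]

/-! ### The action when the rays of a cone are orthogonal -/

section Orthogonal

variable {ι : Type*} [Fintype ι] {e : Module.Basis ι ℚ (NQ N)}

/-- Here `M(σ)` is spanned by the members of the orthonormal dual basis with index outside `t`, so
projecting onto it discards the coordinates in `t`. -/
theorem proj_dualInner_apply [DecidableEq ι] {σ : F.cones} {t : Finset ι} (hσ : σ.1 = basisCone e t)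
    (m : MQ N) (x : NQ N) :
    ((F.complementsOfInner (dualInner e) (dualInner_isSymm e) (dualInner_pos e)).proj σ m : MQ N) x =
      ∑ i ∈ tᶜ, e.repr x i * m (e i) := by
  set p := (F.complementsOfInner (dualInner e) (dualInner_isSymm e) (dualInner_pos e)).proj σ m
  have h1 : ∀ i ∈ t, (p : MQ N) (e i) = 0 := fun i hi =>
    apply_eq_zero_of_mem_perp p.2 (hσ ▸ (basis_mem_basisCone_iff e).2 hi)
  have h2 : ∀ i, i ∉ t → (p : MQ N) (e i) = m (e i) := by
    intro i hi
    have hmem : e.coord i ∈ perp σ.1 := by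
      rw [perp, Submodule.mem_dualAnnihilator]
      intro y hy
      rw [hσ] at hy
      exact (mem_linSpan_basisCone_iff e).1 hy i hi
    have h3 : dualInner e (e.coord i) (p : MQ N) = dualInner e (e.coord i) m :=
      bilin_projectionOnto _ _ m hmem
    simpa [dualInner_apply, Finsupp.single_apply] using h3
  conv_lhs => rw [← e.sum_repr x]
  rw [map_sum, ← Finset.sum_compl_add_sum t, Finset.sum_eq_zero (s := t), add_zero]
  · refine Finset.sum_congr rfl fun i hi => ?_
    rw [map_smul, smul_eq_mul, h2 i (Finset.mem_compl.1 hi)]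
  · intro i hi
    rw [map_smul, h1 i hi, smul_zero]

variable {r : ι → F.Ray}

/-- The normalizing factor of the cycle of the cone generated by the rays with index in `t`. -/
def cycleWeight (e : Module.Basis ι ℚ (NQ N)) (r : ι → F.Ray) (a : F.Ray → ℚ) (t : Finset ι) : ℚ :=
  (∏ i ∈ t, a (r i)) / multiplicity e (fun i => F.rayGenerator (r i)) t

theorem cycleWeight_ne_zero [Module.Free ℤ N] (hr : ∀ i, e i = toNQ N (F.rayGenerator (r i)))
    {a : F.Ray → ℚ} (ha : ∀ ρ, a ρ ≠ 0) (t : Finset ι) : cycleWeight e r a t ≠ 0 := by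
  classical
  exact div_ne_zero (Finset.prod_ne_zero_iff.2 fun i _ => ha _)
    (by exact_mod_cast (multiplicity_pos hr t).ne')

/-- The generator `n` lies in `τ`, so after projection only its `j`-th coordinate `1 / k`
contributes, giving `a_j / k`. As `k` is the ratio of the two multiplicities, this is the ratio of
the weights. -/
theorem actMatrix_dualInner_insert [Module.Free ℤ N] [DecidableEq ι] (hF : F.IsSimplicial)
    (hr : ∀ i, e i = toNQ N (F.rayGenerator (r i)) ∧ (r i).1.1 = basisCone e {i})
    {a : F.Ray → ℚ} (ha : ∀ ρ, a ρ ≠ 0) {σ τ : F.cones} {t : Finset ι} {j : ι} (hj : j ∉ t)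
    (hσ : σ.1 = basisCone e t) (hτ : τ.1 = basisCone e (insert j t)) :
    (F.complementsOfInner (dualInner e) (dualInner_isSymm e) (dualInner_pos e)).actMatrix
        (∑ ρ, a ρ • F.rayDivisor hF ρ) σ τ =
      cycleWeight e r a (insert j t) / cycleWeight e r a t := by
  have hfacet : IsFacetOf σ.1 τ.1 := by
    rw [hσ, hτ]; exact isFacetOf_basisCone_insert e hj
  have hspec := facetGenerator_spec hfacet
  obtain ⟨d, hd⟩ := Submodule.mkQ_surjective _ ((∑ ρ, a ρ • F.rayDivisor hF ρ : F.QCartier).1 τ)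
  have hdj : d (e j) = a (r j) := by
    rw [(hr j).1]
    refine apply_rayGenerator_of_mkQ_eq hF a hd ?_
    rw [(hr j).2, hτ, basisCone_le_iff]
    simp
  rw [Complements.actMatrix, Matrix.of_apply, dif_pos hfacet, ← hd]
  change ((F.complementsOfInner _ _ _).proj σ d : MQ N) (toNQ N (facetGenerator hfacet)) = _
  generalize facetGenerator hfacet = n at hspec
  rw [hσ, hτ] at hspec
  obtain ⟨k, hk, hkn, hmul⟩ := exists_multiplicity_insert
    (v := fun i => F.rayGenerator (r i)) (fun i => (hr i).1) hj hspec
  have hn := (mem_basisCone_iff e).1 hspec.mem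
  rw [proj_dualInner_apply hσ, Finset.sum_eq_single j]
  · have h1 : (multiplicity e (fun i => F.rayGenerator (r i)) t : ℚ) ≠ 0 := by
      exact_mod_cast (multiplicity_pos (fun i => (hr i).1) t).ne'
    have h2 : (k : ℚ) ≠ 0 := by exact_mod_cast hk.ne'
    have h3 : ∏ i ∈ t, a (r i) ≠ 0 := Finset.prod_ne_zero_iff.2 fun i _ => ha _
    have h4 : e.repr (toNQ N n) j = 1 / k := eq_div_of_mul_eq h2 (by rwa [mul_comm])
    rw [hdj, cycleWeight, cycleWeight, hmul, Finset.prod_insert hj, h4]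
    push_cast
    field_simp
  · intro i hi hij
    rw [(hn i).2 (by simpa [hij] using hi), zero_mul]
  · intro hc
    exact absurd (Finset.mem_compl.2 hj) hc

/-- Along every chain from `t` to `u` the ratios of weights telescope to the same value, and there
are `k!` chains, one for each order of adding the elements of `u \ t`. -/
theorem actMatrix_pow_dualInner [Module.Free ℤ N] [DecidableEq ι] (hF : F.IsSimplicial)
    (hr : ∀ i, e i = toNQ N (F.rayGenerator (r i)) ∧ (r i).1.1 = basisCone e {i})
    {a : F.Ray → ℚ} (ha : ∀ ρ, a ρ ≠ 0) {c : Finset ι → F.cones} (hc : ∀ t, (c t).1 = basisCone e t)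
    (k : ℕ) {t u : Finset ι} (htu : t ⊆ u) (hk : u.card = t.card + k) :
    ((F.complementsOfInner (dualInner e) (dualInner_isSymm e) (dualInner_pos e)).actMatrix
        (∑ ρ, a ρ • F.rayDivisor hF ρ) ^ k) (c t) (c u) =
      k.factorial * (cycleWeight e r a u / cycleWeight e r a t) := by
  have hw := cycleWeight_ne_zero (e := e) (fun i => (hr i).1) ha
  have hcinj : Function.Injective c := fun t u h => basisCone_injective e (by rw [← hc, ← hc, h])
  induction k generalizing u with
  | zero =>
    have : t = u := Finset.eq_of_subset_of_card_le htu (by omega)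
    subst this
    simp [div_self (hw t)]
  | succ k ih =>
    rw [pow_succ, Matrix.mul_apply]
    have hsum : ∀ j ∈ u \ t, ((F.complementsOfInner (dualInner e) (dualInner_isSymm e)
        (dualInner_pos e)).actMatrix (∑ ρ, a ρ • F.rayDivisor hF ρ) ^ k) (c t) (c (u.erase j)) *
        (F.complementsOfInner (dualInner e) (dualInner_isSymm e)
        (dualInner_pos e)).actMatrix (∑ ρ, a ρ • F.rayDivisor hF ρ) (c (u.erase j)) (c u) =
        k.factorial * (cycleWeight e r a u / cycleWeight e r a t) := by
      intro j hj
      rw [Finset.mem_sdiff] at hj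
      have hins : insert j (u.erase j) = u := Finset.insert_erase hj.1
      rw [ih (Finset.subset_erase.2 ⟨htu, hj.2⟩) (by rw [Finset.card_erase_of_mem hj.1, hk]; rfl),
        actMatrix_dualInner_insert hF hr ha (Finset.notMem_erase j u) (hc _)
          ((hc u).trans (by rw [hins])), hins]
      have := hw (u.erase j)
      field_simp
    -- The only intermediate cones that contribute are the facets of `c u` containing `c t`: one
    -- removes an element of `u \ t`.
    rw [← Finset.sum_of_injOn (s := u \ t) (fun j => c (u.erase j)) ?_ ?_ ?_
      fun j hj => (hsum j hj).symm]
    · rw [Finset.sum_const, Finset.card_sdiff_of_subset htu, hk, nsmul_eq_mul,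
        Nat.factorial_succ, Nat.add_sub_cancel_left]
      push_cast
      ring
    · intro j hj j' hj' h
      have hj1 := (Finset.mem_sdiff.1 hj).1
      have hj1' := (Finset.mem_sdiff.1 hj').1
      exact Finset.erase_injOn u hj1 hj1' (hcinj h)
    · exact fun _ _ => Finset.mem_coe.2 (Finset.mem_univ _)
    · intro υ _ hυ
      by_contra hne
      have h1 := (Complements.le_and_dim_eq_of_actMatrix_pow_ne_zero (left_ne_zero_of_mul hne)).1
      have h2 := Complements.isFacetOf_of_actMatrix_ne_zero (right_ne_zero_of_mul hne)
      have h3 := h2.dim_eq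
      rw [hc] at h1
      have h4 := h2.face
      rw [hc] at h4
      obtain ⟨s, hsu, hs⟩ := exists_eq_basisCone_of_isFaceOf e h4
      rw [hs, basisCone_le_iff] at h1
      rw [hc, hs, dim_basisCone, dim_basisCone] at h3
      obtain ⟨j, hju, hjs⟩ : ∃ j ∈ u, j ∉ s := by
        by_contra! hcon
        have := Finset.card_le_card (show u ⊆ s from hcon)
        omega
      refine hυ ⟨j, Finset.mem_coe.2 (Finset.mem_sdiff.2 ⟨hju, fun hjt => hjs (h1 hjt)⟩), ?_⟩
      have h5 : s = u.erase j := Finset.eq_of_subset_of_card_le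
        (Finset.subset_erase.2 ⟨hsu, hjs⟩) (by rw [Finset.card_erase_of_mem hju]; omega)
      exact Subtype.ext (by rw [hc, hs, h5])

/-- For the inner product that makes the rays of a full-dimensional cone orthogonal, the action on
the cycles of its faces is injective in the stated degrees. -/
theorem eq_zero_of_actMatrix_pow_dualInner [Module.Free ℤ N] (hF : F.IsSimplicial)
    (hr : ∀ i, e i = toNQ N (F.rayGenerator (r i)) ∧ (r i).1.1 = basisCone e {i})
    {a : F.Ray → ℚ} (ha : ∀ ρ, a ρ ≠ 0) {γ : F.cones} (hγ : γ.1 = basisCone e Finset.univ)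
    {i : ℕ} (hi : 2 * i ≤ Fintype.card ι) {x : F.cones → ℚ} (hx : ∀ σ, dim σ.1 ≠ i → x σ = 0)
    (h : ∀ τ : F.cones, τ.1 ≤ γ.1 → dim τ.1 + i = Fintype.card ι →
      ∑ σ, x σ * ((F.complementsOfInner (dualInner e) (dualInner_isSymm e)
        (dualInner_pos e)).actMatrix (∑ ρ, a ρ • F.rayDivisor hF ρ) ^ (Fintype.card ι - 2 * i))
          σ τ = 0) (σ : F.cones) (hσ : σ.1 ≤ γ.1) : x σ = 0 := by
  classical
  have hw := cycleWeight_ne_zero (e := e) (fun i => (hr i).1) ha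
  set M := (F.complementsOfInner (dualInner e) (dualInner_isSymm e)
        (dualInner_pos e)).actMatrix (∑ ρ, a ρ • F.rayDivisor hF ρ) with hM
  have hface : ∀ t : Finset ι, basisCone e t ∈ F.cones := fun t =>
    F.face_mem _ γ.2 _ (hγ ▸ basisCone_isFaceOf e (Finset.subset_univ t))
  let c : Finset ι → F.cones := fun t => ⟨basisCone e t, hface t⟩
  have hc : ∀ t, (c t).1 = basisCone e t := fun t => rfl
  have hcinj : Function.Injective c := fun t u h => basisCone_injective e (by rw [← hc, ← hc, h])
  have hle : ∀ t, (c t).1 ≤ γ.1 := fun t => by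
    rw [hc, hγ, basisCone_le_iff]; exact Finset.subset_univ t
  have hex : ∀ σ : F.cones, ∀ u, σ.1 ≤ (c u).1 → ∃ t ⊆ u, σ = c t := by
    intro σ u hσ
    obtain ⟨t, ht, hσt⟩ := exists_eq_basisCone_of_isFaceOf e (F.isFaceOf_of_le hσ)
    exact ⟨t, ht, Subtype.ext hσt⟩
  -- the equations persist in higher degrees
  have hup : ∀ u : Finset ι, ∀ l, u.card + i = Fintype.card ι + l →
      ∑ σ, x σ * (M ^ (Fintype.card ι - 2 * i + l)) σ (c u) = 0 := by
    intro u l hl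
    simp_rw [pow_add, Matrix.mul_apply, Finset.mul_sum, ← mul_assoc]
    rw [Finset.sum_comm]
    refine Finset.sum_eq_zero fun υ _ => ?_
    rw [← Finset.sum_mul]
    -- If `υ` contributes, it is a face of `c u`, hence of `γ`, and has dimension `n - i`, so the
    -- hypothesis applies at `υ`.
    by_cases hυ : (M ^ l) υ (c u) = 0
    · rw [hυ, mul_zero]
    · have h1 := Complements.le_and_dim_eq_of_actMatrix_pow_ne_zero hυ
      rw [h υ (h1.1.trans (hle u)), zero_mul]
      have h2 := h1.2
      rw [hc, dim_basisCone] at h2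
      omega
  -- After division by the non-zero factor `(|u| - i)! · w_u` the equations become unweighted subset
  -- sums of `x / w`. All codimensions up to `i` are needed for the inclusion–exclusion.
  have hsub : ∀ u : Finset ι, Fintype.card ι ≤ u.card + i →
      ∑ t ∈ u.powersetCard i, x (c t) / cycleWeight e r a t = 0 := by
    intro u hu
    have h1 := hup u (u.card + i - Fintype.card ι) (by omega)
    -- No subtraction is truncated here, because `2i ≤ n` and `n ≤ |u| + i`.
    have hk : Fintype.card ι - 2 * i + (u.card + i - Fintype.card ι) = u.card - i := by omega
    rw [hk, ← Finset.sum_of_injOn (s := u.powersetCard i) c (hcinj.injOn)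
      (fun _ _ => Finset.mem_coe.2 (Finset.mem_univ _)) ?_ (fun t _ => rfl)] at h1
    · have h2 : ∀ t ∈ u.powersetCard i, x (c t) * (M ^ (u.card - i)) (c t) (c u) =
          ((u.card - i).factorial * cycleWeight e r a u) * (x (c t) / cycleWeight e r a t) := by
        intro t ht
        rw [Finset.mem_powersetCard] at ht
        rw [hM, actMatrix_pow_dualInner hF hr ha hc _ ht.1 (by omega)]
        ring
      rw [Finset.sum_congr rfl h2, ← Finset.mul_sum] at h1
      refine (mul_eq_zero.1 h1).resolve_left (mul_ne_zero ?_ (hw u))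
      exact_mod_cast Nat.factorial_ne_zero _
    · intro σ _ hσ
      by_contra hne
      have h2 := Complements.le_and_dim_eq_of_actMatrix_pow_ne_zero (right_ne_zero_of_mul hne)
      obtain ⟨t, htu, rfl⟩ := hex σ u h2.1
      have h3 : dim (c t).1 = i := by
        by_contra hd
        exact left_ne_zero_of_mul hne (hx _ hd)
      rw [hc, dim_basisCone] at h3
      exact hσ ⟨t, Finset.mem_coe.2 (Finset.mem_powersetCard.2 ⟨htu, h3⟩), rfl⟩
  obtain ⟨t, -, rfl⟩ := hex σ Finset.univ (by rw [hc, ← hγ]; exact hσ)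
  by_cases ht : t.card = i
  · have h1 := eq_zero_of_sum_powersetCard_eq_zero i _ hsub t ht
    exact (div_eq_zero_iff.1 h1).resolve_right (hw t)
  · exact hx _ (by rwa [hc, dim_basisCone])

end Orthogonal

end Fan

/-! ### From one inner product to generic ones -/

/-- A left inverse `L` found at one inner product gives the certificate `det (L * W) ≠ 0` for
injectivity of `W` at others, with no identification of the row and column index types. -/
theorem exists_mul_eq_one_of_mulVec_injective {I J : Type*} [Fintype I] [Fintype J] [DecidableEq I]
    [DecidableEq J] (W : Matrix J I ℚ) (h : ∀ y, W.mulVec y = 0 → y = 0) :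
    ∃ L : Matrix I J ℚ, L * W = 1 := by
  obtain ⟨g, hg⟩ := LinearMap.exists_leftInverse_of_injective (Matrix.toLin' W)
    (LinearMap.ker_eq_bot'.2 fun y hy => h y (by rwa [Matrix.toLin'_apply] at hy))
  refine ⟨LinearMap.toMatrix' g, ?_⟩
  rw [← LinearMap.toMatrix'_toLin' W, ← LinearMap.toMatrix'_comp, hg, LinearMap.toMatrix'_id]

namespace Fan

variable {N : Type*} [AddCommGroup N] [Module.Finite ℤ N] {F : Fan N}

/-- For a generic inner product multiplication by `ω^(n - 2i)` is injective on the coefficients of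
the faces of a given full-dimensional cone. -/
theorem exists_polynomial_injective_on_faces [Module.Free ℤ N] (hF : F.IsSimplicial)
    {a : F.Ray → ℚ} (ha : ∀ ρ, a ρ ≠ 0) {n : ℕ} (b : Module.Basis (Fin n) ℚ (MQ N))
    (γ : F.cones) (hγ : dim γ.1 = Module.finrank ℤ N) {i : ℕ} (hi : 2 * i ≤ Module.finrank ℤ N) :
    ∃ p : MvPolynomial (Fin n × Fin n) ℚ,
      (∃ A : Matrix (Fin n) (Fin n) ℚ, A.IsSymm ∧
        MvPolynomial.eval (fun ij => A ij.1 ij.2) p ≠ 0) ∧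
      ∀ (A : Matrix (Fin n) (Fin n) ℚ) (hs : (Matrix.toBilin b A).IsSymm)
        (hp : ∀ m, m ≠ 0 → 0 < Matrix.toBilin b A m m),
        MvPolynomial.eval (fun ij => A ij.1 ij.2) p ≠ 0 →
        ∀ x ∈ F.Z (Module.finrank ℤ N - i),
          ((F.complementsOfInner (Matrix.toBilin b A) hs hp).act
            (∑ ρ, a ρ • F.rayDivisor hF ρ) ^ (Module.finrank ℤ N - 2 * i)) x = 0 →
          ∀ σ : F.cones, σ.1 ≤ γ.1 → x σ = 0 := by
  classical
  set D := ∑ ρ, a ρ • F.rayDivisor hF ρ with hD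
  set k := Module.finrank ℤ N - 2 * i with hk
  let I : Type _ := {σ : F.cones // σ.1 ≤ γ.1 ∧ dim σ.1 = i}
  let J : Type _ := {τ : F.cones // τ.1 ≤ γ.1 ∧ dim τ.1 + i = Module.finrank ℤ N}
  -- The block of `M ^ k` between faces of `γ`, transposed so that columns are the sources.
  let w : ∀ {R : Type} [CommRing R], Matrix F.cones F.cones R → Matrix J I R :=
    fun M => Matrix.of fun τ σ => (M ^ k) σ.1 τ.1
  obtain ⟨ι, _, e, r, hcard, hγe, hr⟩ := exists_rayBasis hF γ hγ
  obtain ⟨P, q, hPq⟩ := exists_polynomial_actMatrix D b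
  -- sums over all cones against a source supported on the faces of `γ`
  have hsum : ∀ (C : F.Complements) (x : F.cones → ℚ), (∀ σ, dim σ.1 ≠ i → x σ = 0) →
      ∀ τ : J, ∑ σ, x σ * (C.actMatrix D ^ k) σ τ.1 =
        (w (C.actMatrix D)).mulVec (fun σ : I => x σ.1) τ := by
    intro C x hx τ
    rw [Matrix.mulVec, dotProduct]
    symm
    refine Finset.sum_of_injOn (fun σ : I => σ.1) (Subtype.val_injective.injOn)
      (fun _ _ => Finset.mem_coe.2 (Finset.mem_univ _)) ?_ (fun σ _ => mul_comm _ _)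
    intro σ _ hσ
    by_contra hne
    have h1 := (Complements.le_and_dim_eq_of_actMatrix_pow_ne_zero (right_ne_zero_of_mul hne)).1
    refine hσ ⟨⟨σ, h1.trans τ.2.1, ?_⟩, Finset.mem_coe.2 (Finset.mem_univ _), rfl⟩
    by_contra hd
    exact left_ne_zero_of_mul hne (hx σ hd)
  set C₀ := F.complementsOfInner (dualInner e) (dualInner_isSymm e) (dualInner_pos e) with hC₀
  obtain ⟨L, hL⟩ := exists_mul_eq_one_of_mulVec_injective (w (C₀.actMatrix D)) (by
    intro y hy
    let x : F.cones → ℚ := fun σ => if h : σ.1 ≤ γ.1 ∧ dim σ.1 = i then y ⟨σ, h⟩ else 0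
    have hx : ∀ σ, dim σ.1 ≠ i → x σ = 0 := fun σ hσ => dif_neg fun h => hσ h.2
    have hxy : (fun σ : I => x σ.1) = y := funext fun σ => dif_pos σ.2
    funext σ
    have h1 := eq_zero_of_actMatrix_pow_dualInner hF hr ha hγe (hcard ▸ hi) hx
      (fun τ hτ hτi => by
        rw [hcard] at hτi ⊢
        rw [← hD, ← hC₀, ← hk, hsum C₀ x hx ⟨τ, hτ, hτi⟩, hxy, hy, Pi.zero_apply]) σ.1 σ.2.1
    rw [← hxy]
    exact h1)
  -- The constant matrix `L` inverts the block at the special inner product. At any inner product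
  -- the determinant of `Q` differs from that of `L` times the block by a non-zero factor: `q ^ k`
  -- from the `k`-th power, once for each of the `|I|` rows.
  let Q : Matrix I I (MvPolynomial (Fin n × Fin n) ℚ) := L.map MvPolynomial.C * w P
  have heval : ∀ (A : Matrix (Fin n) (Fin n) ℚ) (hs : (Matrix.toBilin b A).IsSymm)
      (hp : ∀ m, m ≠ 0 → 0 < Matrix.toBilin b A m m),
      MvPolynomial.eval (fun ij => A ij.1 ij.2) Q.det =
        (MvPolynomial.eval (fun ij => A ij.1 ij.2) q ^ k) ^ Fintype.card I *
          (L * w ((F.complementsOfInner (Matrix.toBilin b A) hs hp).actMatrix D)).det := by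
    intro A hs hp
    set ev := MvPolynomial.eval (fun ij : Fin n × Fin n => A ij.1 ij.2)
    have h1 := (hPq A hs hp).2
    have h2 : ev.mapMatrix (P ^ k) = ev q ^ k •
        ((F.complementsOfInner (Matrix.toBilin b A) hs hp).actMatrix D) ^ k := by
      rw [map_pow, h1, smul_pow]
    rw [RingHom.map_det, ← Matrix.det_smul, ← Matrix.mul_smul]
    congr 1
    rw [RingHom.mapMatrix_apply,
      show Q.map ev = (L.map MvPolynomial.C).map ev * (w P).map ev from Matrix.map_mul]
    congr 1
    · ext i j
      simp [ev]
    · ext τ σ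
      exact congrFun (congrFun h2 σ.1) τ.1
  refine ⟨Q.det,
    ⟨LinearMap.BilinForm.toMatrix b (dualInner e), ?_, ?_⟩, ?_⟩
  · exact (LinearMap.BilinForm.isSymm_toMatrix_iff_isSymm b).2 (dualInner_isSymm e)
  · have hB : Matrix.toBilin b (LinearMap.BilinForm.toMatrix b (dualInner e)) = dualInner e :=
      Matrix.toBilin_toMatrix b _
    have hs : (Matrix.toBilin b (LinearMap.BilinForm.toMatrix b (dualInner e))).IsSymm :=
      hB.symm ▸ dualInner_isSymm e
    have hp : ∀ m, m ≠ 0 →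
        0 < Matrix.toBilin b (LinearMap.BilinForm.toMatrix b (dualInner e)) m m :=
      hB.symm ▸ dualInner_pos e
    have hC : F.complementsOfInner _ hs hp = C₀ := by
      rw [hC₀]
      congr 1
    rw [heval _ hs hp, hC, hL, Matrix.det_one, mul_one]
    exact pow_ne_zero _ (pow_ne_zero _ (hPq _ hs hp).1)
  · intro A hs hp hA x hx hx0 σ hσ
    rw [heval A hs hp] at hA
    have hx' : ∀ σ, dim σ.1 ≠ i → x σ = 0 := by
      intro σ hd
      by_contra hne
      have h1 := (Finsupp.mem_supported _ _).1 hx (Finsupp.mem_support_iff.2 hne)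
      rw [Set.mem_ofPred_eq] at h1
      omega
    have hW : (w ((F.complementsOfInner (Matrix.toBilin b A) hs hp).actMatrix D)).mulVec
        (fun σ : I => x σ.1) = 0 := by
      funext τ
      rw [← hsum _ x hx', ← Complements.act_pow_apply, hx0, Finsupp.zero_apply, Pi.zero_apply]
    by_cases hd : dim σ.1 = i
    -- The block kills the coefficients of `x`, hence so does `L` times the block, which is
    -- invertible.
    · have h1 := Matrix.eq_zero_of_mulVec_eq_zero (right_ne_zero_of_mul hA)
        (v := fun σ : I => x σ.1) (by rw [← Matrix.mulVec_mulVec, hW, Matrix.mulVec_zero])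
      exact congrFun h1 ⟨σ, hσ, hd⟩
    · exact hx' σ hd

end Fan

end Toric

end

/-! ### Combining all cones and degrees -/

/-- Let `F` be a simplicial fan all of whose maximal cones have dimension `n = rank N`, and let
`ω = ∑ a_i D_i` with all `a_i ≠ 0`.  For a generic inner product on `M_ℚ`, multiplication by
`ω^(n - 2i)` maps `Z_{n-i}(X)_ℚ` injectively into `Z_i(X)_ℚ` for all `0 ≤ i ≤ n/2`. -/
theorem theorem10p1 {N : Type*} [AddCommGroup N] [Module.Free ℤ N] [Module.Finite ℤ N]
    (F : Toric.Fan N) (hF : F.IsSimplicial) (hpure : F.IsPure)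
    (a : F.Ray → ℚ) (ha : ∀ ρ, a ρ ≠ 0) :
    Toric.ForGenericInner (Toric.MQ N) fun B hs hp =>
      ∀ i : ℕ, 2 * i ≤ Module.finrank ℤ N →
        Set.MapsTo
            (((F.complementsOfInner B hs hp).act (∑ ρ, a ρ • F.rayDivisor hF ρ)) ^
              (Module.finrank ℤ N - 2 * i))
            (F.Z (Module.finrank ℤ N - i)) (F.Z i) ∧
          Set.InjOn
            (((F.complementsOfInner B hs hp).act (∑ ρ, a ρ • F.rayDivisor hF ρ)) ^
              (Module.finrank ℤ N - 2 * i))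
            (F.Z (Module.finrank ℤ N - i)) := by
  classical
  intro b
  -- Bounding `i` by `n` makes the index type finite, so that one product of polynomials serves all
  -- cones and degrees.
  let κ : Type _ := {γ : F.cones // Toric.dim γ.1 = Module.finrank ℤ N} ×
    {i : Fin (Module.finrank ℤ N + 1) // 2 * i.1 ≤ Module.finrank ℤ N}
  choose p hp0 hp using fun k : κ =>
    Toric.Fan.exists_polynomial_injective_on_faces hF ha b k.1.1 k.1.2 k.2.2
  obtain ⟨A₀, hA₀, hne⟩ :=
    Toric.exists_isSymm_eval_prod_ne_zero Finset.univ p fun k _ => hp0 k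
  refine ⟨{A | MvPolynomial.eval (fun ij => A.1 ij.1 ij.2) (∏ k, p k) ≠ 0}, ⟨⟨A₀, hA₀⟩, hne⟩,
    ⟨{∏ k, p k}, by simp⟩, fun A hA hs hpos i hi => ⟨?_, ?_⟩⟩
  · exact Toric.Fan.Complements.mapsTo_act_pow _ _ (by omega)
  · intro x hx y hy hxy
    rw [← sub_eq_zero]
    ext σ
    -- Purity places `σ` in a full-dimensional `γ`; non-vanishing of the factor for `(γ, i)` kills
    -- the coefficient at `σ`.
    obtain ⟨γ, hγ, hσγ, hdim⟩ := hpure σ.1 σ.2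
    rw [Set.mem_ofPred_eq, map_prod] at hA
    refine hp (⟨⟨γ, hγ⟩, hdim⟩, ⟨⟨i, by omega⟩, hi⟩) A.1 hs hpos
      (Finset.prod_ne_zero_iff.1 hA _ (Finset.mem_univ _)) (x - y) (sub_mem hx hy) ?_ σ hσγ
    rw [map_sub, sub_eq_zero]
    exact hxy
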